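/- A Minsky machine has finitely many control states (one of them initial) and finitely many counters, at least one, with values in $\mathbb N$; each control state carries one instruction: increment a counter and go to a given state; test a counter and, if it is positive, decrement it and go to one given state, otherwise leave it and go to another given state; or halt. It accepts $m\in\mathbb N$ if, started in the initial state with first counter $m$ and all other counters $0$, it reaches a halt instruction. A weighted automaton over a finite alphabet $\Gamma$ is a tuple $\mathcal A=(Q,\Gamma,\iota,\mu,F)$ with a finite set $Q$ of states, $\iota\in Q$, $F\subseteq Q$ and $\mu:Q\times\Gamma\times Q\to\{-\infty,0,1\}$. A run with label $w=a_1\cdots a_k\in\Gamma^+$ is a sequence $(q_0,a_1,q_1)\cdots(q_{k-1},a_k,q_k)$ with $q_0=\iota$, $q_k\in F$ and $\mu(q_{i-1},a_i,q_i)\neq-\infty$ for all $i$; its weight is the number of $i$ with $\mu(q_{i-1},a_i,q_i)=1$. The behaviour $\|\mathcal A\|:\Gamma^+\to\mathbb N\cup\{-\infty\}$ maps $w$ to the maximal weight of a run with label $w$ ($-\infty$ if there is none). For words $u,v\in\Sigma^*$, the convolution $u\otimes v$ is the word over $\Sigma_\#^2=(\Sigma\cup\{\#\})^2$ of length $\max(|u|,|v|)$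 whose $i$-th letter is the pair of the $i$-th letters of $u$ and $v$, where the shorter word is padded with $\#\notin\Sigma$. Write $\le_{\mathrm{pref}}$ for the prefix relation. There is an explicit construction that turns every Minsky machine $\mathcal M$ into a finite alphabet $\Sigma$ with distinct letters $\$,\Box,a$, a regular language $\mathrm{CT_{reg}}\subseteq(\Sigma\cdot\Box)^+$, weighted automata $\mathcal A$ and $\mathcal A_{\mathcal M}$ over $\Sigma$, and a weighted automaton $\mathcal B_{\mathcal M}$ over $\Sigma_\#^2$, such that the following hold. For $m\in\mathbb N$ and $u\in\Sigma^+$, write $P(m,u)$ for the statement $m=\max\{n\mid \$\Box(a\Box)^n\le_{\mathrm{pref}}u\}$ (which includes that the maximum exists). (a) $\|\mathcal A\|(u)\in\mathbb N$ for all $u\in\Sigma^+$; and for every $m\in\mathbb N$, $m$ is not accepted by $\mathcal M$ if and only if $\|\mathcal A\|(u)>\frac12|u|$ for all $u\in\mathrm{CT_{reg}}$ with $P(m,u)$. (b) $\|\mathcal A_{\mathcal M}\|(u)=\max(\lfloor\frac{|u|}2\rfloor+1,\|\mathcal A\|(u))$ for all $u\in\Sigma^+$. (c) For all $x\in(\Sigma_\#^2)^+$: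 if $x=u\otimes\$\Box(a\Box)^m$ with $u\in\Sigma^+$ and $m\in\mathbb N$, then $\|\mathcal B_{\mathcal M}\|(x)=\|\mathcal A\|(u)$ in case $u\in\mathrm{CT_{reg}}$ and $P(m,u)$, and $\|\mathcal B_{\mathcal M}\|(x)=\|\mathcal A_{\mathcal M}\|(u)$ otherwise; if $x$ is not of this form, then $\|\mathcal B_{\mathcal M}\|(x)=0$. (d) For $m\in\mathbb N$ and $u\in\Sigma^+$ put $r_{\mathcal M,m}(u)=\|\mathcal B_{\mathcal M}\|(u\otimes\$\Box(a\Box)^m)$. Then $r_{\mathcal M,m}(u)\in\mathbb N$, and for every $m\in\mathbb N$ the following are equivalent: (1) $m$ is not accepted by $\mathcal M$; (2) $\|\mathcal A_{\mathcal M}\|(u)=r_{\mathcal M,m}(u)$ for all $u\in\Sigma^+$. -/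

import Mathlib

/-! ### Minsky machines -/

/-- Instructions of a counter machine with counters `Fin (k + 1)` and control states `Fin (n + 1)`:
increment a counter; test a counter and, if it is positive, decrement it and go to the first state,
if it is zero, leave it unchanged and go to the second state; halt. -/
inductive MinskyInstr (k n : ℕ) : Type
  | inc (c : Fin (k + 1)) (q : Fin (n + 1)) : MinskyInstr k n
  | dec (c : Fin (k + 1)) (pos zero : Fin (n + 1)) : MinskyInstr k n
  | halt : MinskyInstr k n
  deriving DecidableEq

/-- A (deterministic) Minsky machine with an arbitrary positive number of counters and an arbitrary
positive number of control states; state `0` is initial, and counter `0` holds the input. -/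
structure MinskyMachine : Type where
  k : ℕ
  n : ℕ
  instr : Fin (n + 1) → MinskyInstr k n

namespace MinskyMachine

abbrev Counter (M : MinskyMachine) : Type := Fin (M.k + 1)

abbrev State (M : MinskyMachine) : Type := Fin (M.n + 1)

/-- Configurations: a control state and the values of the counters. -/
abbrev Config (M : MinskyMachine) : Type := M.State × (M.Counter → ℕ)

/-- The successor configuration (none, if the machine halts). -/
def step (M : MinskyMachine) (κ : M.Config) : Option M.Config :=
  match M.instr κ.1 with
  | .inc c q => some (q, Function.update κ.2 c (κ.2 c + 1))
  | .dec c pos zero =>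
      if κ.2 c = 0 then some (zero, κ.2) else some (pos, Function.update κ.2 c (κ.2 c - 1))
  | .halt => none

/-- The initial configuration on input `m`: counter `0` is `m`, all other counters are zero. -/
def initial (M : MinskyMachine) (m : ℕ) : M.Config := (0, Pi.single 0 m)

/-- `m` is accepted if the computation on input `m` reaches a halting instruction. -/
def Accepts (M : MinskyMachine) (m : ℕ) : Prop :=
  ∃ κ : M.Config, Relation.ReflTransGen (fun κ₁ κ₂ => M.step κ₁ = some κ₂) (M.initial m) κ ∧
    M.instr κ.1 = .halt

end MinskyMachine

/-! ### Weighted automata with weights `-∞`, `0`, `1` -/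

/-- A weighted automaton over the alphabet `α`: a finite set of states, an initial state, the
weight function (where `⊥` stands for `-∞`) and the (decidable) set of accepting states. -/
structure WeightedAutomaton (α : Type) : Type 1 where
  Q : Type
  [finiteQ : Finite Q]
  [decEqQ : DecidableEq Q]
  init : Q
  weight : Q → α → Q → WithBot (Fin 2)
  final : Q → Bool

attribute [instance] WeightedAutomaton.finiteQ WeightedAutomaton.decEqQ

namespace WeightedAutomaton

/-- `A.IsPath p ρ r`: the list `ρ` of transitions of weight `≠ -∞` leads from `p` to `r`. -/
def IsPath {α : Type} (A : WeightedAutomaton α) : A.Q → List (A.Q × α × A.Q) → A.Q → Prop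
  | p, [], r => p = r
  | p, t :: ρ, r => t.1 = p ∧ A.weight t.1 t.2.1 t.2.2 ≠ ⊥ ∧ A.IsPath t.2.2 ρ r

/-- Runs: nonempty paths from the initial state to an accepting state. -/
def IsRun {α : Type} (A : WeightedAutomaton α) (ρ : List (A.Q × α × A.Q)) : Prop :=
  ρ ≠ [] ∧ ∃ f, A.final f = true ∧ A.IsPath A.init ρ f

/-- The label of a run. -/
def label {α : Type} (A : WeightedAutomaton α) (ρ : List (A.Q × α × A.Q)) : List α :=
  ρ.map (fun t => t.2.1)

/-- The weight of a run: the number of its positions that carry a transition of weight `1`. -/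
def wt {α : Type} (A : WeightedAutomaton α) (ρ : List (A.Q × α × A.Q)) : ℕ :=
  ρ.countP (fun t => A.weight t.1 t.2.1 t.2.2 = 1)

/-- The weights of the runs with label `w`. -/
def runWeights {α : Type} (A : WeightedAutomaton α) (w : List α) : Set ℕ :=
  {n | ∃ ρ, A.IsRun ρ ∧ A.label ρ = w ∧ A.wt ρ = n}

open Classical in
/-- The behaviour: the maximal weight of a run with label `w` (`⊥`, i.e. `-∞`, if there is none).
The lemma `behaviour_eq_coe_iff` below confirms that it is a maximum. -/
noncomputable def behaviour {α : Type} (A : WeightedAutomaton α) (w : List α) : WithBot ℕ :=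
  if (A.runWeights w).Nonempty then ((sSup (A.runWeights w) : ℕ) : WithBot ℕ) else ⊥

theorem runWeights_bddAbove {α : Type} (A : WeightedAutomaton α) (w : List α) :
    BddAbove (A.runWeights w) := by
  refine ⟨w.length, ?_⟩
  rintro n ⟨ρ, -, rfl, rfl⟩
  simpa [label, wt] using List.countP_le_length

theorem behaviour_eq_coe_iff {α : Type} (A : WeightedAutomaton α) (w : List α) (n : ℕ) :
    A.behaviour w = (n : WithBot ℕ) ↔ IsGreatest (A.runWeights w) n := by
  unfold behaviour
  split_ifs with h
  · have hg : IsGreatest (A.runWeights w) (sSup (A.runWeights w)) :=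
      ⟨Nat.sSup_mem h (A.runWeights_bddAbove w), fun _ hx =>
        le_csSup (A.runWeights_bddAbove w) hx⟩
    constructor
    · intro e
      have e' : sSup (A.runWeights w) = n := by exact_mod_cast e
      exact e' ▸ hg
    · intro e
      rw [hg.unique e]
  · constructor
    · intro e
      exact absurd e (WithBot.bot_ne_coe)
    · intro e
      exact absurd ⟨n, e.1⟩ h

end WeightedAutomaton

/-- The convolution `u ⊗ v` of two words, over the alphabet `(Σ ∪ {#})²`; the padding symbol `#`
is `none`. -/
def convolution {α β : Type} : List α → List β → List (Option α × Option β)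
  | [], [] => []
  | x :: u, [] => (some x, none) :: convolution u []
  | [], y :: v => (none, some y) :: convolution [] v
  | x :: u, y :: v => (some x, some y) :: convolution u v

namespace MinskyMachine

/-! ### The alphabet and the language of potential computation traces

A configuration with control state `q` is written as the letter `q`, followed by a word of counter
letters, in any order, in which each counter occurs as often as its value says. A computation is
written as the concatenation of its configurations, with a `□` inserted after each letter. -/

/-- The alphabet `Σ` of the machine `M`. -/
inductive Letter (M : MinskyMachine) : Type
  | box : Letter M
  | state (q : M.State) : Letter M
  | counter (c : M.Counter) : Letter M
  deriving DecidableEq, Fintype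

/-- The letter `□`. -/
abbrev sqr (M : MinskyMachine) : M.Letter := .box

/-- The letter `$`, which stands for the initial state. -/
abbrev dollar (M : MinskyMachine) : M.Letter := .state 0

/-- The letter `a`, which stands for the input counter. -/
abbrev a (M : MinskyMachine) : M.Letter := .counter 0

/-- The word `$□(a□)^m`. -/
def initWord (M : MinskyMachine) (m : ℕ) : List M.Letter :=
  M.dollar :: M.sqr :: (List.replicate m [M.a, M.sqr]).flatten

/-- Does the instruction of state `q` test and decrement the counter `c`? -/
def tests (M : MinskyMachine) (q : M.State) (c : M.Counter) : Bool :=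
  match M.instr q with
  | .dec c' _ _ => decide (c' = c)
  | _ => false

/-- The next control state after `q`, if `pos` tells whether the counter that is tested by the
instruction of `q` (if any) is positive. -/
def nextState (M : MinskyMachine) (q : M.State) (pos : Bool) : Option M.State :=
  match M.instr q with
  | .inc _ p => some p
  | .dec _ p z => if pos then some p else some z
  | .halt => none

/-- States of the automaton for potential traces. In `block q first seen expectBox`, the control
state of the current configuration is `q`, the configuration is the first one iff `first`, the
counter tested by `q` has already occurred in it iff `seen`, and the next letter has to be `□`
iff `expectBox`. -/
inductive CTState (M : MinskyMachine) : Type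
  | start : CTState M
  | block (q : M.State) (first seen expectBox : Bool) : CTState M
  | dead : CTState M
  deriving DecidableEq, Fintype

def ctStep (M : MinskyMachine) : M.CTState → M.Letter → M.CTState
  | .start, .state q => if q = 0 then .block q true false true else .dead
  | .block q f s true, .box => .block q f s false
  | .block q f s false, .counter c =>
      if f = true ∧ c ≠ 0 then .dead else .block q f (s || M.tests q c) true
  | .block q _ s false, .state p =>
      if M.nextState q s = some p then .block p false false true else .dead
  | _, _ => .dead

def ctAccept (M : MinskyMachine) : M.CTState → Bool
  | .block q _ _ false => decide (M.instr q = .halt)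
  | _ => false

/-- The finite automaton for `CT_reg`: the word has the form of a halting computation (with all
counters but the input counter initially zero), in which the control states are correct relative
to the zero tests; the changes of the counter values are not checked. -/
def ctDFA (M : MinskyMachine) : DFA M.Letter M.CTState where
  step := M.ctStep
  start := .start
  accept := {s | M.ctAccept s = true}

/-- The language `CT_reg`. -/
def CTreg (M : MinskyMachine) : Language M.Letter := M.ctDFA.accepts

/-! ### The weighted automaton `A`

It reads a potential trace and guesses two consecutive configurations and a counter `c` whose value
in the second one is too small (`low = true`) or too large (`low = false`). A pair `x□` has weight
`0`, `1` or `2`; it is `1` except for the letters that take part in the comparison. -/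

inductive ErrState (M : MinskyMachine) : Type
  | idle : ErrState M
  | first (c : M.Counter) (low : Bool) (q : M.State) (seen pend : Bool) : ErrState M
  | second (c : M.Counter) (low pend : Bool) : ErrState M
  | done : ErrState M
  deriving DecidableEq, Fintype

/-- One plus the change (if `low`), or one minus the change (if not `low`), of counter `c` under
the instruction of `q`, where `pos` tells whether `c` is positive. -/
def delta (M : MinskyMachine) (c : M.Counter) (low : Bool) (q : M.State) (pos : Bool) : ℕ :=
  match M.instr q with
  | .inc c' _ => if c' = c then (if low then 2 else 0) else 1
  | .dec c' _ _ => if c' = c ∧ pos = true then (if low then 0 else 2) else 1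
  | .halt => 1

/-- The deterministic part of the transitions of `A`: successor state and weight. The flag `pend`
says that the following `□` has weight one. -/
def errNext (M : MinskyMachine) : M.ErrState → M.Letter → M.ErrState × Fin 2
  | .idle, .box => (.idle, 0)
  | .idle, _ => (.idle, 1)
  | .first c l q s pend, .box => (.first c l q s false, if pend then 1 else 0)
  | .first c l q s _, .counter c' =>
      if c' = c then (.first c l q true l, if l then 1 else 0) else (.first c l q s false, 1)
  | .first c l q s _, .state _ =>
      (.second c l (decide (M.delta c l q s = 2)), if M.delta c l q s = 0 then 0 else 1)
  | .second c l pend, .box => (.second c l false, if pend then 1 else 0)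
  | .second c l _, .counter c' =>
      if c' = c then (.second c l (!l), if l then 0 else 1) else (.second c l false, 1)
  | .second _ _ _, .state _ => (.done, 1)
  | .done, .box => (.done, 0)
  | .done, _ => (.done, 1)

/-- The nondeterministic guess: may `A` pass from `s` to `t` reading `x` in order to start a
comparison with the configuration that begins with `x`? -/
def errGuess (M : MinskyMachine) : M.ErrState → M.Letter → M.ErrState → Bool
  | .idle, .state q, .first _ _ q' false false => decide (q' = q)
  | _, _, _ => false

def errFinal (M : MinskyMachine) : M.ErrState → Bool
  | .first _ _ _ _ _ => false
  | _ => true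

/-- The weighted automaton `A`. -/
def autA (M : MinskyMachine) : WeightedAutomaton M.Letter where
  Q := M.ErrState
  init := .idle
  weight s x t :=
    if t = (M.errNext s x).1 then ((M.errNext s x).2 : Fin 2)
    else if M.errGuess s x t then ((1 : Fin 2) : WithBot (Fin 2)) else ⊥
  final := M.errFinal

end MinskyMachine

/-! ### The weighted automaton `A_M` -/

/-- States of the automaton that simulates an automaton with state set `Q` or counts half of the
letters of the input. -/
inductive HalfState (Q : Type) : Type
  | start : HalfState Q
  | sim (q : Q) : HalfState Q
  | odd : HalfState Q
  | even : HalfState Q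
  deriving DecidableEq, Fintype

instance {Q : Type} [Finite Q] : Finite (HalfState Q) := by
  have := Fintype.ofFinite Q
  infer_instance

def WeightedAutomaton.halfFinal {α : Type} (A : WeightedAutomaton α) : HalfState A.Q → Bool
  | .start => false
  | .sim q => A.final q
  | .odd => true
  | .even => true

/-- A weighted automaton for the maximum of `⌊|u|/2⌋ + 1` and the behaviour of `A`. -/
def WeightedAutomaton.maxHalf {α : Type} (A : WeightedAutomaton α) : WeightedAutomaton α where
  Q := HalfState A.Q
  init := .start
  weight s x t :=
    match s, t with
    | .start, .sim q => A.weight A.init x q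
    | .start, .odd => ((1 : Fin 2) : WithBot (Fin 2))
    | .sim p, .sim q => A.weight p x q
    | .odd, .even => ((1 : Fin 2) : WithBot (Fin 2))
    | .even, .odd => ((0 : Fin 2) : WithBot (Fin 2))
    | _, _ => ⊥
  final := A.halfFinal

namespace MinskyMachine

/-- The weighted automaton `A_M`. -/
def autAM (M : MinskyMachine) : WeightedAutomaton M.Letter := M.autA.maxHalf

/-! ### The weighted automaton `B_M` -/

/-- Status of the first track: it has to be a nonempty word, followed by padding. -/
inductive FirstTrack : Type
  | empty | running | ended | dead
  deriving DecidableEq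

instance : Fintype FirstTrack :=
  ⟨{.empty, .running, .ended, .dead}, fun x => by cases x <;> simp⟩

/-- Status of the second track: it has to be `$□(a□)^m`, followed by padding. -/
inductive SecondTrack : Type
  | start | dollar | full | a | ended | dead
  deriving DecidableEq

instance : Fintype SecondTrack :=
  ⟨{.start, .dollar, .full, .a, .ended, .dead}, fun x => by cases x <;> simp⟩

/-- Comparison of the tracks: the second track has so far been a prefix of the first; it has ended
as a prefix of the first and was not followed by `a` there; otherwise. -/
inductive Comparison : Type
  | same | longer | failed
  deriving DecidableEq

instance : Fintype Comparison :=
  ⟨{.same, .longer, .failed}, fun x => by cases x <;> simp⟩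

/-- States of the finite automaton that monitors both tracks; `ct` is the state of the automaton
for `CT_reg` on the first track. -/
structure Monitor (M : MinskyMachine) : Type where
  first : FirstTrack
  second : SecondTrack
  comparison : Comparison
  ct : M.CTState
  deriving DecidableEq, Fintype

def firstStep {β γ : Type} : FirstTrack → Option β × Option γ → FirstTrack
  | .empty, (some _, _) => .running
  | .running, (some _, _) => .running
  | .running, (none, some _) => .ended
  | .ended, (none, some _) => .ended
  | _, _ => .dead

def secondStep (M : MinskyMachine) : SecondTrack → Option M.Letter → SecondTrack
  | .start, some x => if x = M.dollar then .dollar else .dead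
  | .dollar, some x => if x = M.sqr then .full else .dead
  | .full, some x => if x = M.a then .a else .dead
  | .a, some x => if x = M.sqr then .full else .dead
  | .full, none => .ended
  | .ended, none => .ended
  | _, _ => .dead

def compareStep (M : MinskyMachine) :
    Comparison → Option M.Letter × Option M.Letter → Comparison
  | .same, (some x, some y) => if x = y then .same else .failed
  | .same, (some x, none) => if x = M.a then .failed else .longer
  | .same, (none, _) => .failed
  | .longer, _ => .longer
  | .failed, _ => .failed

def monitorInit (M : MinskyMachine) : M.Monitor := ⟨.empty, .start, .same, .start⟩

def monitorStep (M : MinskyMachine) (s : M.Monitor) (x : Option M.Letter × Option M.Letter) :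
    M.Monitor where
  first := firstStep s.first x
  second := M.secondStep s.second x.2
  comparison := M.compareStep s.comparison x
  ct :=
    match x.1 with
    | some y => M.ctStep s.ct y
    | none => s.ct

/-- The input is of the form `u ⊗ $□(a□)^m` with `u` nonempty. -/
def monitorValid (M : MinskyMachine) (s : M.Monitor) : Bool :=
  decide ((s.first = .running ∨ s.first = .ended) ∧ (s.second = .full ∨ s.second = .ended))

/-- The first track is in `CT_reg` and its maximal prefix in `$□(a□)*` is the second track
(for valid inputs). -/
def monitorTrace (M : MinskyMachine) (s : M.Monitor) : Bool :=
  M.ctAccept s.ct && decide (s.comparison ≠ .failed)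

/-- Simulation of an automaton on the first track; on padding the state is kept with weight `0`. -/
def padWeight {α : Type} (A : WeightedAutomaton α) (p : A.Q) (x : Option α) (q : A.Q) :
    WithBot (Fin 2) :=
  match x with
  | some y => A.weight p y q
  | none => if q = p then ((0 : Fin 2) : WithBot (Fin 2)) else ⊥

/-- `B_M` guesses which of the three cases applies and, on the first track, simulates `A` (first
summand) or `A_M` (second summand) or does nothing (third summand). -/
abbrev Mode (M : MinskyMachine) : Type := M.autA.Q ⊕ M.autAM.Q ⊕ Unit

def modeWeight (M : MinskyMachine) :
    M.Mode → Option M.Letter → M.Mode → WithBot (Fin 2)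
  | .inl p, x, .inl q => padWeight M.autA p x q
  | .inr (.inl p), x, .inr (.inl q) => padWeight M.autAM p x q
  | .inr (.inr _), _, .inr (.inr _) => ((0 : Fin 2) : WithBot (Fin 2))
  | _, _, _ => ⊥

/-- The initial state of the simulation of the same kind as a given mode. -/
def modeInit (M : MinskyMachine) : M.Mode → M.Mode
  | .inl _ => .inl M.autA.init
  | .inr (.inl _) => .inr (.inl M.autAM.init)
  | .inr (.inr _) => .inr (.inr ())

def modeFinal (M : MinskyMachine) (s : M.Monitor) : M.Mode → Bool
  | .inl q => M.monitorValid s && M.monitorTrace s && M.autA.final q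
  | .inr (.inl q) => M.monitorValid s && !M.monitorTrace s && M.autAM.final q
  | .inr (.inr _) => !M.monitorValid s

/-- The weighted automaton `B_M`; the state `none` is the initial one. -/
def autBM (M : MinskyMachine) : WeightedAutomaton (Option M.Letter × Option M.Letter) where
  Q := Option (M.Monitor × M.Mode)
  init := none
  weight s x t :=
    match s, t with
    | none, some (d', i') =>
        if d' = M.monitorStep M.monitorInit x then M.modeWeight (M.modeInit i') x.1 i' else ⊥
    | some (d, i), some (d', i') =>
        if d' = M.monitorStep d x then M.modeWeight i x.1 i' else ⊥
    | _, none => ⊥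
  final := fun s => s.elim false (fun d => M.modeFinal d.1 d.2)

/-- The function `r_{M,m}`: the behaviour of `B_M` with the second track fixed to `$□(a□)^m`. -/
noncomputable def r (M : MinskyMachine) (m : ℕ) (u : List M.Letter) : WithBot ℕ :=
  M.autBM.behaviour (convolution u (M.initWord m))

/-- `m = max {n | $□(a□)^n is a prefix of u}` -/
def IsMaxInit (M : MinskyMachine) (m : ℕ) (u : List M.Letter) : Prop :=
  IsGreatest {n : ℕ | M.initWord n <+: u} m

end MinskyMachine

/-! A word of `CTreg` is a padded sequence of configurations whose control states are correct
relative to the zero tests; only the counter changes may be wrong. A run of `autA` that never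
guesses gives each pair `x□` weight 1, hence total weight exactly half the length. A run that
guesses a counter `c` and a sign compares two consecutive configurations: occurrences of `c` in the
first, the prescribed change, and occurrences in the second shift the weight so that the total is
half the length plus or minus (expected value minus actual value), see `errRun_first`. So no
accepting run exceeds half the length if and only if every comparison is balanced, that is, if and
only if the trace is a genuine halting computation (`IsComputation.weight_le`,
`IsTrace.isComputation`). The prefix `$□(a□)^m` fixes the input, which gives `not_accepts_iff`.

`maxHalf` adds to the run weights of an automaton exactly one value, half the length rounded down
plus 1 (`maxHalf_runWeights`). `autBM` runs a deterministic monitor beside one of three simulations,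
and the monitor decides at the end which of them may accept (`mem_autBM_runWeights`). Thus `r`
agrees with the behaviour of `autAM` except on traces with input `m`, where it equals that of
`autA`; there the two agree if and only if the behaviour of `autA` exceeds half the length. This
reduces the last equivalence to `not_accepts_iff`. -/

namespace WeightedAutomaton

/-! ### Runs as weighted reachability, by recursion on the label -/

/-- Some path from `p` to `f` with label `w` has weight `n`. -/
def Reaches {α : Type} (A : WeightedAutomaton α) : A.Q → List α → ℕ → A.Q → Prop
  | p, [], n, f => p = f ∧ n = 0
  | p, x :: w, n, f => ∃ (q : A.Q) (k : Fin 2) (n' : ℕ),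
      A.weight p x q = (k : WithBot (Fin 2)) ∧ A.Reaches q w n' f ∧ n = k + n'

theorem ite_coe_eq_one (k : Fin 2) :
    (if decide ((k : WithBot (Fin 2)) = 1) = true then 1 else 0) = (k : ℕ) := by
  have h : ((k : WithBot (Fin 2)) = 1) ↔ k = 1 := WithBot.coe_inj (a := k) (b := 1)
  simp only [h, decide_eq_true_eq]
  fin_cases k <;> rfl

theorem exists_isPath_iff_reaches {α : Type} (A : WeightedAutomaton α) (w : List α) :
    ∀ (p : A.Q) (n : ℕ) (f : A.Q),
      (∃ ρ, A.IsPath p ρ f ∧ A.label ρ = w ∧ A.wt ρ = n) ↔ A.Reaches p w n f := by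
  induction w with
  | nil =>
    intro p n f
    constructor
    · rintro ⟨ρ, h, hl, rfl⟩
      obtain rfl : ρ = [] := by simpa [label] using hl
      exact ⟨h, rfl⟩
    · rintro ⟨rfl, rfl⟩
      exact ⟨[], rfl, rfl, rfl⟩
  | cons x w ih =>
    intro p n f
    constructor
    · rintro ⟨ρ, h, hl, rfl⟩
      obtain _ | ⟨⟨p', x', q⟩, ρ⟩ := ρ
      · simp [label] at hl
      · obtain ⟨rfl, hb, hp⟩ := h
        simp only [label, List.map_cons, List.cons.injEq] at hl
        obtain ⟨rfl, hl⟩ := hl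
        obtain ⟨k, hk⟩ := WithBot.ne_bot_iff_exists.1 hb
        refine ⟨q, k, A.wt ρ, hk.symm, (ih _ _ _).1 ⟨ρ, hp, hl, rfl⟩, ?_⟩
        simp only [wt, List.countP_cons, ← hk]
        rw [ite_coe_eq_one, add_comm]
    · rintro ⟨q, k, n', hk, hr, rfl⟩
      obtain ⟨ρ, hp, hl, rfl⟩ := (ih _ _ _).2 hr
      refine ⟨(p, x, q) :: ρ, ⟨rfl, by simp [hk], hp⟩, by simpa [label] using hl, ?_⟩
      simp only [wt, List.countP_cons, hk]
      rw [ite_coe_eq_one, add_comm]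

theorem mem_runWeights_iff {α : Type} (A : WeightedAutomaton α) {w : List α} (hw : w ≠ [])
    {n : ℕ} : n ∈ A.runWeights w ↔ ∃ f, A.final f = true ∧ A.Reaches A.init w n f := by
  constructor
  · rintro ⟨ρ, ⟨-, f, hf, hp⟩, hl, hn⟩
    exact ⟨f, hf, (A.exists_isPath_iff_reaches _ _ _ _).1 ⟨ρ, hp, hl, hn⟩⟩
  · rintro ⟨f, hf, hr⟩
    obtain ⟨ρ, hp, hl, hn⟩ := (A.exists_isPath_iff_reaches _ _ _ _).2 hr
    refine ⟨ρ, ⟨?_, f, hf, hp⟩, hl, hn⟩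
    rintro rfl
    exact hw (by simpa [label] using hl.symm)

theorem behaviour_congr {α β : Type} {A : WeightedAutomaton α} {B : WeightedAutomaton β}
    {u : List α} {v : List β} (h : A.runWeights u = B.runWeights v) :
    A.behaviour u = B.behaviour v := by
  unfold behaviour
  rw [h]

theorem exists_behaviour_eq_coe {α : Type} {A : WeightedAutomaton α} {u : List α}
    (h : (A.runWeights u).Nonempty) : ∃ n : ℕ, A.behaviour u = (n : WithBot ℕ) :=
  ⟨_, if_pos h⟩

/-- Adding one weight to a set changes its maximum to the larger of the two; if `A` has no run on
`u`, the maximum with `⊥` is `k` itself. -/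
theorem behaviour_insert {α β : Type} {A : WeightedAutomaton α} {B : WeightedAutomaton β}
    {u : List α} {v : List β} {k : ℕ} (h : B.runWeights v = insert k (A.runWeights u)) :
    B.behaviour v = max (k : WithBot ℕ) (A.behaviour u) := by
  by_cases hne : (A.runWeights u).Nonempty
  · obtain ⟨n, hn⟩ := exists_behaviour_eq_coe hne
    have hg := (A.behaviour_eq_coe_iff u n).1 hn
    rw [hn, (B.behaviour_eq_coe_iff v (max k n)).2 (h ▸ hg.insert k)]
    rfl
  · have he : A.runWeights u = ∅ := Set.not_nonempty_iff_eq_empty.1 hne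
    rw [he] at h
    have hA : A.behaviour u = ⊥ := if_neg hne
    rw [hA, max_bot_right, B.behaviour_eq_coe_iff, h]
    simp

/-! ### The maximum of a behaviour and half the length -/

theorem maxHalf_reaches_sim {α : Type} (A : WeightedAutomaton α) (w : List α) :
    ∀ (p : A.Q) (n : ℕ) (f : HalfState A.Q), A.maxHalf.Reaches (.sim p) w n f ↔
      ∃ q, f = .sim q ∧ A.Reaches p w n q := by
  induction w with
  | nil =>
    intro p n f
    constructor
    · rintro ⟨rfl, rfl⟩
      exact ⟨p, rfl, rfl, rfl⟩
    · rintro ⟨q, rfl, rfl, rfl⟩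
      exact ⟨rfl, rfl⟩
  | cons x w ih =>
    intro p n f
    constructor
    · rintro ⟨q, k, n', hk, hr, rfl⟩
      cases q with
      | sim q =>
        obtain ⟨q', rfl, hr'⟩ := (ih _ _ _).1 hr
        exact ⟨q', rfl, q, k, n', hk, hr', rfl⟩
      | _ => exact absurd hk WithBot.bot_ne_coe
    · rintro ⟨q', rfl, q, k, n', hk, hr, rfl⟩
      exact ⟨.sim q, k, n', hk, (ih _ _ _).2 ⟨q', rfl, hr⟩, rfl⟩

/-- The two counting states alternate with weights 1 (from `odd`) and 0 (from `even`), so the count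
from `odd` rounds up. The first letter of the input enters `odd` with weight 1, whence the extra 1
in `maxHalf_runWeights`. -/
theorem maxHalf_reaches_count {α : Type} (A : WeightedAutomaton α) (w : List α) :
    (∀ (n : ℕ) (f : HalfState A.Q), A.maxHalf.Reaches .odd w n f →
      n = (w.length + 1) / 2) ∧
    (∀ (n : ℕ) (f : HalfState A.Q), A.maxHalf.Reaches .even w n f → n = w.length / 2) ∧
    (∃ f, A.maxHalf.final f = true ∧ A.maxHalf.Reaches .odd w ((w.length + 1) / 2) f) ∧
    (∃ f, A.maxHalf.final f = true ∧ A.maxHalf.Reaches .even w (w.length / 2) f) := by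
  induction w with
  | nil =>
    refine ⟨fun n f h => by simpa using h.2, fun n f h => by simpa using h.2,
      ⟨.odd, rfl, rfl, by simp⟩, ⟨.even, rfl, rfl, by simp⟩⟩
  | cons x w ih =>
    obtain ⟨h1, h2, ⟨f, hf, h3⟩, ⟨f', hf', h4⟩⟩ := ih
    refine ⟨?_, ?_, ⟨f', hf', .even, 1, _, rfl, h4, ?_⟩, ⟨f, hf, .odd, 0, _, rfl, h3, ?_⟩⟩
    · rintro n f ⟨q, k, n', hk, hr, rfl⟩
      cases q with
      | even =>
        obtain rfl : 1 = k := WithBot.coe_injective hk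
        rw [h2 _ _ hr]
        simp
        omega
      | _ => exact absurd hk WithBot.bot_ne_coe
    · rintro n f ⟨q, k, n', hk, hr, rfl⟩
      cases q with
      | odd =>
        obtain rfl : 0 = k := WithBot.coe_injective hk
        rw [h1 _ _ hr]
        simp
      | _ => exact absurd hk WithBot.bot_ne_coe
    · simp
      omega
    · simp

theorem maxHalf_runWeights {α : Type} (A : WeightedAutomaton α) {u : List α} (hu : u ≠ []) :
    A.maxHalf.runWeights u = insert (u.length / 2 + 1) (A.runWeights u) := by
  obtain _ | ⟨x, w⟩ := u
  · exact absurd rfl hu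
  obtain ⟨h1, -, ⟨f, hf, h3⟩, -⟩ := A.maxHalf_reaches_count w
  ext n
  rw [Set.mem_insert_iff, mem_runWeights_iff _ hu, mem_runWeights_iff _ hu]
  constructor
  · rintro ⟨f, hf, q, k, n', hk, hr, rfl⟩
    cases q with
    | sim q =>
      obtain ⟨q', rfl, hr'⟩ := (A.maxHalf_reaches_sim w _ _ _).1 hr
      exact .inr ⟨q', hf, q, k, n', hk, hr', rfl⟩
    | odd =>
      left
      obtain rfl : 1 = k := WithBot.coe_injective hk
      rw [h1 _ _ hr]
      simp
      omega
    | _ => exact absurd hk WithBot.bot_ne_coe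
  · rintro (rfl | ⟨f, hf, q, k, n', hk, hr, rfl⟩)
    · refine ⟨f, hf, .odd, 1, _, rfl, h3, ?_⟩
      simp
      omega
    · exact ⟨.sim f, hf, .sim q, k, n', hk, (A.maxHalf_reaches_sim w _ _ _).2 ⟨f, rfl, hr⟩, rfl⟩

theorem maxHalf_behaviour {α : Type} (A : WeightedAutomaton α) {u : List α} (hu : u ≠ []) :
    A.maxHalf.behaviour u = max ((u.length / 2 + 1 : ℕ) : WithBot ℕ) (A.behaviour u) :=
  behaviour_insert (A.maxHalf_runWeights hu)

end WeightedAutomaton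

/-! ### The runs of the product automaton `autBM` -/

theorem convolution_map_fst {α β : Type} : ∀ (u : List α) (v : List β),
    (convolution u v).filterMap Prod.fst = u
  | [], [] => by simp [convolution]
  | x :: u, [] => by simp [convolution, convolution_map_fst u []]
  | [], y :: v => by simp [convolution, convolution_map_fst [] v]
  | x :: u, y :: v => by simp [convolution, convolution_map_fst u v]

namespace MinskyMachine

variable (M : MinskyMachine)

/-- The state of the monitor after reading `x` in state `d`. -/
def monitorRun (d : M.Monitor) (x : List (Option M.Letter × Option M.Letter)) : M.Monitor :=
  x.foldl M.monitorStep d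

theorem padWeight_eq_coe_none {α : Type} (A : WeightedAutomaton α) (p q : A.Q) (k : Fin 2) :
    padWeight A p none q = (k : WithBot (Fin 2)) ↔ q = p ∧ k = 0 := by
  unfold padWeight
  split_ifs with h
  · rw [WithBot.coe_inj, eq_comm]
    simp [h]
  · simp [h]

theorem autBM_weight_eq_coe (d : M.Monitor) (i : M.Mode)
    (e : Option M.Letter × Option M.Letter) (s : M.autBM.Q) (k : Fin 2) :
    M.autBM.weight (some (d, i)) e s = (k : WithBot (Fin 2)) ↔
      ∃ i', s = some (M.monitorStep d e, i') ∧ M.modeWeight i e.1 i' = (k : WithBot (Fin 2)) := by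
  constructor
  · intro hk
    obtain _ | ⟨d', i'⟩ := s
    · exact absurd hk WithBot.bot_ne_coe
    · by_cases hd : d' = M.monitorStep d e
      · subst hd
        exact ⟨i', rfl, (if_pos rfl).symm.trans hk⟩
      · exact absurd ((if_neg hd).symm.trans hk) WithBot.bot_ne_coe
  · rintro ⟨i', rfl, hk⟩
    exact (if_pos rfl).trans hk

/-- The monitor component is deterministic, and padding keeps the simulated state at weight 0. Hence
the simulation sees exactly the first track with its padding deleted. -/
theorem autBM_reaches_inl (x : List (Option M.Letter × Option M.Letter)) :
    ∀ (d : M.Monitor) (p : M.autA.Q) (n : ℕ) (f : M.autBM.Q),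
      M.autBM.Reaches (some (d, .inl p)) x n f ↔ ∃ q, f = some (M.monitorRun d x, .inl q) ∧
        M.autA.Reaches p (x.filterMap Prod.fst) n q := by
  induction x with
  | nil =>
    intro d p n f
    constructor
    · rintro ⟨rfl, rfl⟩
      exact ⟨p, rfl, rfl, rfl⟩
    · rintro ⟨q, rfl, rfl, rfl⟩
      exact ⟨rfl, rfl⟩
  | cons e x ih =>
    obtain ⟨e, e'⟩ := e
    intro d p n f
    have key : M.autBM.Reaches (some (d, .inl p)) ((e, e') :: x) n f ↔
        ∃ (q : M.autA.Q) (k : Fin 2) (n' : ℕ), padWeight M.autA p e q = k ∧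
          M.autBM.Reaches (some (M.monitorStep d (e, e'), .inl q)) x n' f ∧ n = k + n' := by
      constructor
      · rintro ⟨s, k, n', hk, hr, rfl⟩
        obtain ⟨q | q | q, rfl, hk'⟩ := (M.autBM_weight_eq_coe _ _ _ _ _).1 hk
        all_goals first
          | exact absurd hk' WithBot.bot_ne_coe
          | exact ⟨q, k, n', hk', hr, rfl⟩
      · rintro ⟨q, k, n', hk, hr, rfl⟩
        exact ⟨_, k, n', (M.autBM_weight_eq_coe d _ _ _ _).2 ⟨.inl q, rfl, hk⟩, hr, rfl⟩
    rw [key]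
    simp only [ih]
    cases e with
    | none =>
      simp only [padWeight_eq_coe_none]
      constructor
      · rintro ⟨q, k, n', ⟨rfl, rfl⟩, ⟨q', rfl, hr⟩, rfl⟩
        exact ⟨q', rfl, by simpa using hr⟩
      · rintro ⟨q', rfl, hr⟩
        exact ⟨p, 0, n, ⟨rfl, rfl⟩, ⟨q', rfl, by simpa using hr⟩, by simp⟩
    | some y =>
      constructor
      · rintro ⟨q, k, n', hk, ⟨q', rfl, hr⟩, rfl⟩
        exact ⟨q', rfl, q, k, n', hk, hr, rfl⟩
      · rintro ⟨q', rfl, q, k, n', hk, hr, rfl⟩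
        exact ⟨q, k, n', hk, ⟨q', rfl, hr⟩, rfl⟩

theorem autBM_reaches_inr_inl (x : List (Option M.Letter × Option M.Letter)) :
    ∀ (d : M.Monitor) (p : M.autAM.Q) (n : ℕ) (f : M.autBM.Q),
      M.autBM.Reaches (some (d, .inr (.inl p))) x n f ↔
        ∃ q, f = some (M.monitorRun d x, .inr (.inl q)) ∧
          M.autAM.Reaches p (x.filterMap Prod.fst) n q := by
  induction x with
  | nil =>
    intro d p n f
    constructor
    · rintro ⟨rfl, rfl⟩
      exact ⟨p, rfl, rfl, rfl⟩
    · rintro ⟨q, rfl, rfl, rfl⟩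
      exact ⟨rfl, rfl⟩
  | cons e x ih =>
    obtain ⟨e, e'⟩ := e
    intro d p n f
    have key : M.autBM.Reaches (some (d, .inr (.inl p))) ((e, e') :: x) n f ↔
        ∃ (q : M.autAM.Q) (k : Fin 2) (n' : ℕ), padWeight M.autAM p e q = k ∧
          M.autBM.Reaches (some (M.monitorStep d (e, e'), .inr (.inl q))) x n' f ∧
            n = k + n' := by
      constructor
      · rintro ⟨s, k, n', hk, hr, rfl⟩
        obtain ⟨q | q | q, rfl, hk'⟩ := (M.autBM_weight_eq_coe _ _ _ _ _).1 hk
        all_goals first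
          | exact absurd hk' WithBot.bot_ne_coe
          | exact ⟨q, k, n', hk', hr, rfl⟩
      · rintro ⟨q, k, n', hk, hr, rfl⟩
        exact ⟨_, k, n', (M.autBM_weight_eq_coe d _ _ _ _).2 ⟨.inr (.inl q), rfl, hk⟩, hr, rfl⟩
    rw [key]
    simp only [ih]
    cases e with
    | none =>
      simp only [padWeight_eq_coe_none]
      constructor
      · rintro ⟨q, k, n', ⟨rfl, rfl⟩, ⟨q', rfl, hr⟩, rfl⟩
        exact ⟨q', rfl, by simpa using hr⟩
      · rintro ⟨q', rfl, hr⟩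
        exact ⟨p, 0, n, ⟨rfl, rfl⟩, ⟨q', rfl, by simpa using hr⟩, by simp⟩
    | some y =>
      constructor
      · rintro ⟨q, k, n', hk, ⟨q', rfl, hr⟩, rfl⟩
        exact ⟨q', rfl, q, k, n', hk, hr, rfl⟩
      · rintro ⟨q', rfl, q, k, n', hk, hr, rfl⟩
        exact ⟨q, k, n', hk, ⟨q', rfl, hr⟩, rfl⟩

theorem autBM_reaches_inr_inr (x : List (Option M.Letter × Option M.Letter)) :
    ∀ (d : M.Monitor) (n : ℕ) (f : M.autBM.Q),
      M.autBM.Reaches (some (d, .inr (.inr ()))) x n f ↔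
        f = some (M.monitorRun d x, .inr (.inr ())) ∧ n = 0 := by
  induction x with
  | nil =>
    intro d n f
    exact and_congr_left' eq_comm
  | cons e x ih =>
    intro d n f
    constructor
    · rintro ⟨s, k, n', hk, hr, rfl⟩
      obtain ⟨q | q | q, rfl, hk'⟩ := (M.autBM_weight_eq_coe _ _ _ _ _).1 hk
      · exact absurd hk' WithBot.bot_ne_coe
      · exact absurd hk' WithBot.bot_ne_coe
      · obtain rfl : 0 = k := WithBot.coe_injective hk'
        obtain ⟨rfl, rfl⟩ := (ih _ _ _).1 hr
        exact ⟨rfl, rfl⟩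
    · rintro ⟨rfl, rfl⟩
      exact ⟨_, 0, 0, (M.autBM_weight_eq_coe _ _ _ _ _).2 ⟨_, rfl, rfl⟩,
        (ih _ _ _).2 ⟨rfl, rfl⟩, rfl⟩

/-- The first transition chooses one of the three simulations through its target. The fixed points
of `modeInit` are the three initial modes, so the state `none` can be replaced by a choice among
them. -/
theorem autBM_reaches_init (e : Option M.Letter × Option M.Letter)
    (x : List (Option M.Letter × Option M.Letter)) (n : ℕ) (f : M.autBM.Q) :
    M.autBM.Reaches none (e :: x) n f ↔
      ∃ i, M.modeInit i = i ∧ M.autBM.Reaches (some (M.monitorInit, i)) (e :: x) n f := by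
  constructor
  · rintro ⟨_ | ⟨d', i⟩, k, n', hk, hr, rfl⟩
    · exact absurd hk WithBot.bot_ne_coe
    · exact ⟨M.modeInit i, by rcases i with q | q | q <;> rfl, some (d', i), k, n', hk, hr, rfl⟩
  · rintro ⟨i₀, h₀, s, k, n', hk, hr, rfl⟩
    obtain ⟨i, rfl, hk'⟩ := (M.autBM_weight_eq_coe _ _ _ _ _).1 hk
    -- No transition changes the kind of simulation, so `i` and `i₀` lie in the same summand.
    have h : M.modeInit i = i₀ := by
      rw [← h₀] at hk' ⊢
      rcases i₀ with q | q | q <;> rcases i with p | p | p <;>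
        first | rfl | exact absurd hk' WithBot.bot_ne_coe
    refine ⟨some (M.monitorStep M.monitorInit e, i), k, n', Eq.trans (if_pos rfl) ?_, hr, rfl⟩
    rw [h, hk']

theorem mem_autBM_runWeights {x : List (Option M.Letter × Option M.Letter)} (hx : x ≠ []) (n : ℕ) :
    n ∈ M.autBM.runWeights x ↔
      (M.monitorValid (M.monitorRun M.monitorInit x) = true ∧
        M.monitorTrace (M.monitorRun M.monitorInit x) = true ∧
        ∃ q, M.autA.final q = true ∧
          M.autA.Reaches M.autA.init (x.filterMap Prod.fst) n q) ∨
      (M.monitorValid (M.monitorRun M.monitorInit x) = true ∧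
        M.monitorTrace (M.monitorRun M.monitorInit x) = false ∧
        ∃ q, M.autAM.final q = true ∧
          M.autAM.Reaches M.autAM.init (x.filterMap Prod.fst) n q) ∨
      (M.monitorValid (M.monitorRun M.monitorInit x) = false ∧ n = 0) := by
  rw [WeightedAutomaton.mem_runWeights_iff _ hx]
  obtain _ | ⟨e, x⟩ := x
  · exact absurd rfl hx
  constructor
  · rintro ⟨f, hf, hr⟩
    obtain ⟨i, hi, hr⟩ := (M.autBM_reaches_init _ _ _ _).1 hr
    rcases i with p | p | p
    · obtain ⟨q, rfl, hr'⟩ := (M.autBM_reaches_inl _ _ _ _ _).1 hr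
      cases Sum.inl_injective hi
      simp only [autBM, modeFinal, Option.elim, Bool.and_eq_true] at hf
      exact .inl ⟨hf.1.1, hf.1.2, q, hf.2, hr'⟩
    · obtain ⟨q, rfl, hr'⟩ := (M.autBM_reaches_inr_inl _ _ _ _ _).1 hr
      cases Sum.inl_injective (Sum.inr_injective hi)
      simp only [autBM, modeFinal, Option.elim, Bool.and_eq_true, Bool.not_eq_true'] at hf
      exact .inr (.inl ⟨hf.1.1, hf.1.2, q, hf.2, hr'⟩)
    · obtain ⟨rfl, rfl⟩ := (M.autBM_reaches_inr_inr _ _ _ _).1 hr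
      simp only [autBM, modeFinal, Option.elim, Bool.not_eq_true'] at hf
      exact .inr (.inr ⟨hf, rfl⟩)
  · rintro (⟨h1, h2, q, hq, hr⟩ | ⟨h1, h2, q, hq, hr⟩ | ⟨h1, rfl⟩)
    · refine ⟨_, ?_, (M.autBM_reaches_init _ _ _ _).2
        ⟨.inl M.autA.init, rfl, (M.autBM_reaches_inl _ _ _ _ _).2 ⟨q, rfl, hr⟩⟩⟩
      simp [autBM, modeFinal, h1, h2]
      exact hq
    · refine ⟨_, ?_, (M.autBM_reaches_init _ _ _ _).2
        ⟨.inr (.inl M.autAM.init), rfl, (M.autBM_reaches_inr_inl _ _ _ _ _).2 ⟨q, rfl, hr⟩⟩⟩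
      simp [autBM, modeFinal, h1, h2]
      exact hq
    · refine ⟨_, ?_, (M.autBM_reaches_init _ _ _ _).2
        ⟨.inr (.inr ()), rfl, (M.autBM_reaches_inr_inr _ _ _ _).2 ⟨rfl, rfl⟩⟩⟩
      simp [autBM, modeFinal, h1]

/-! ### The monitor recognises the convolutions with `$□(a□)^m` -/

theorem foldl_firstStep_dead {β γ : Type} (x : List (Option β × Option γ)) :
    x.foldl firstStep .dead = .dead := by
  induction x with
  | nil => rfl
  | cons e x ih => exact ih

theorem foldl_secondStep_dead (y : List (Option M.Letter)) :
    y.foldl M.secondStep .dead = .dead := by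
  induction y with
  | nil => rfl
  | cons e y ih => exact ih

theorem foldl_firstStep_ended {β γ : Type} (x : List (Option β × Option γ))
    (h : x.foldl firstStep .ended = .running ∨ x.foldl firstStep .ended = .ended) :
    ∃ v, x = convolution [] v := by
  induction x with
  | nil => exact ⟨[], by simp [convolution]⟩
  | cons e x ih =>
    obtain ⟨_ | a, _ | b⟩ := e
    · simp [firstStep, foldl_firstStep_dead] at h
    · obtain ⟨v, rfl⟩ := ih h
      exact ⟨b :: v, by simp [convolution]⟩
    · simp [firstStep, foldl_firstStep_dead] at h
    · simp [firstStep, foldl_firstStep_dead] at h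

theorem foldl_secondStep_ended (x : List (Option M.Letter))
    (h : x.foldl M.secondStep .ended = .full ∨ x.foldl M.secondStep .ended = .ended) :
    ∀ e ∈ x, e = none := by
  induction x with
  | nil => simp
  | cons e x ih =>
    obtain _ | a := e
    · simpa using ih h
    · simp [secondStep, foldl_secondStep_dead] at h

theorem secondStep_none (s : SecondTrack) :
    M.secondStep s none = .dead ∨ (s = .full ∨ s = .ended) ∧ M.secondStep s none = .ended := by
  cases s <;> simp [secondStep]

theorem secondStep_some_ne_ended (s : SecondTrack) (b : M.Letter) :
    M.secondStep s (some b) ≠ .ended := by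
  cases s <;> simp [secondStep] <;> split_ifs <;> simp

theorem map_snd_convolution_nil {β γ : Type} (v : List γ) :
    (convolution ([] : List β) v).map Prod.snd = v.map some := by
  induction v with
  | nil => simp [convolution]
  | cons b v ih => simp [convolution, ih]

theorem eq_convolution_nil_of_forall {β γ : Type} (x : List (Option β × Option γ))
    (h₁ : x.foldl firstStep .running = .running ∨ x.foldl firstStep .running = .ended)
    (h₂ : ∀ e ∈ x.map Prod.snd, e = none) : ∃ u, x = convolution u [] := by
  induction x with
  | nil => exact ⟨[], by simp [convolution]⟩
  | cons e x ih =>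
    obtain ⟨_ | a, _ | b⟩ := e
    · simp [firstStep, foldl_firstStep_dead] at h₁
    · simp at h₂
    · obtain ⟨u, rfl⟩ := ih h₁ (fun e he => h₂ e (List.mem_cons_of_mem _ he))
      exact ⟨a :: u, by simp [convolution]⟩
    · simp at h₂

theorem foldl_secondStep_some_ne_ended (v : List M.Letter) :
    ∀ (s : SecondTrack), s ≠ .ended → (v.map some).foldl M.secondStep s ≠ .ended := by
  induction v with
  | nil => exact fun s hs => hs
  | cons b v ih => exact fun s _ => ih _ (M.secondStep_some_ne_ended s b)

/-- Once one track is padded it stays padded, and the letter `(none, none)` kills the first track;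
so the remainder is a convolution with the empty word. The condition `s ≠ .ended` says that padding
of the second track has not begun, and padding can begin only in `full`, so `v` without its padding
ends in `full`. -/
theorem exists_convolution_of_tracks (x : List (Option M.Letter × Option M.Letter)) :
    ∀ (s : SecondTrack), s ≠ .ended →
      (x.foldl firstStep .running = .running ∨ x.foldl firstStep .running = .ended) →
      ((x.map Prod.snd).foldl M.secondStep s = .full ∨
        (x.map Prod.snd).foldl M.secondStep s = .ended) →
      ∃ u v, x = convolution u v ∧ (v.map some).foldl M.secondStep s = .full := by
  induction x with
  | nil =>
    intro s hs _ h
    exact ⟨[], [], by simp [convolution], h.resolve_right hs⟩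
  | cons e x ih =>
    intro s hs h₁ h₂
    obtain ⟨_ | a, _ | b⟩ := e
    · simp [firstStep, foldl_firstStep_dead] at h₁
    · obtain ⟨v, rfl⟩ := foldl_firstStep_ended x h₁
      simp only [List.map_cons, map_snd_convolution_nil] at h₂
      refine ⟨[], b :: v, by simp [convolution], ?_⟩
      exact h₂.resolve_right (M.foldl_secondStep_some_ne_ended (b :: v) s hs)
    · rcases M.secondStep_none s with h | ⟨h, h'⟩
      · simp [h, foldl_secondStep_dead] at h₂
      · obtain rfl := h.resolve_right hs
        obtain ⟨u, rfl⟩ := eq_convolution_nil_of_forall x h₁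
          (M.foldl_secondStep_ended _ h₂)
        exact ⟨a :: u, [], by simp [convolution], rfl⟩
    · obtain ⟨u, v, rfl, h⟩ := ih _ (M.secondStep_some_ne_ended s b) h₁ h₂
      exact ⟨a :: u, b :: v, by simp [convolution], h⟩

theorem foldl_secondStep_full : ∀ v : List M.Letter,
    (v.map some).foldl M.secondStep .full = .full ↔
      ∃ m, v = (List.replicate m [M.a, M.sqr]).flatten
  | [] => iff_of_true rfl ⟨0, rfl⟩
  | [x] => by
    refine iff_of_false ?_ ?_
    · simp [secondStep]
      split_ifs <;> simp
    · rintro ⟨_ | m, hm⟩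
      · simp at hm
      · simp [List.replicate_succ] at hm
  | x :: y :: v => by
    have ih := foldl_secondStep_full v
    by_cases hxy : x = M.a ∧ y = M.sqr
    · obtain ⟨rfl, rfl⟩ := hxy
      have : ((M.a :: M.sqr :: v).map some).foldl M.secondStep .full =
          (v.map some).foldl M.secondStep .full := by simp [secondStep]
      rw [this, ih]
      constructor
      · rintro ⟨m, rfl⟩
        exact ⟨m + 1, by simp [List.replicate_succ]⟩
      · rintro ⟨_ | m, hm⟩
        · simp at hm
        · exact ⟨m, by simpa [List.replicate_succ] using hm⟩
    · refine iff_of_false ?_ ?_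
      · by_cases hx : x = M.a
        · have hy : y ≠ M.sqr := fun hy => hxy ⟨hx, hy⟩
          simp [secondStep, hx, hy, foldl_secondStep_dead]
        · simp [secondStep, hx, foldl_secondStep_dead]
      · rintro ⟨_ | m, hm⟩
        · simp at hm
        · simp only [List.replicate_succ, List.flatten_cons, List.cons_append, List.nil_append,
            List.cons.injEq] at hm
          exact hxy ⟨hm.1, hm.2.1⟩

theorem foldl_secondStep_start (v : List M.Letter) :
    (v.map some).foldl M.secondStep .start = .full ↔ ∃ m, v = M.initWord m := by
  obtain _ | ⟨x, _ | ⟨y, v⟩⟩ := v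
  · simp [initWord]
  · simp [initWord, secondStep]
    split_ifs <;> simp
  · by_cases hx : x = M.dollar
    · by_cases hy : y = M.sqr
      · subst hx hy
        simpa [initWord, secondStep] using M.foldl_secondStep_full v
      · simp [initWord, secondStep, hx, hy, foldl_secondStep_dead]
    · simp [initWord, secondStep, hx, foldl_secondStep_dead]

theorem foldl_firstStep_convolution {β γ : Type} : ∀ (u : List β) (v : List γ),
    (convolution u v).foldl firstStep .running = .running ∨
      (convolution u v).foldl firstStep .running = .ended
  | [], [] => by simp [convolution]
  | x :: u, [] => by simpa [convolution, firstStep] using foldl_firstStep_convolution u []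
  | x :: u, y :: v => by simpa [convolution, firstStep] using foldl_firstStep_convolution u v
  | [], y :: v => by
    have : ∀ w : List γ, (convolution ([] : List β) w).foldl firstStep .ended = .ended := by
      intro w
      induction w with
      | nil => simp [convolution]
      | cons z w ih => simpa [convolution, firstStep] using ih
    simp [convolution, firstStep, this]

theorem foldl_secondStep_convolution : ∀ (u v : List M.Letter) (s : SecondTrack),
    (v.map some).foldl M.secondStep s = .full →
    ((convolution u v).map Prod.snd).foldl M.secondStep s = .full ∨
      ((convolution u v).map Prod.snd).foldl M.secondStep s = .ended
  | [], v, s, h => by simp [map_snd_convolution_nil, h]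
  | x :: u, y :: v, s, h => by
    simpa [convolution] using foldl_secondStep_convolution u v _ h
  | x :: u, [], s, h => by
    have key : ∀ (w : List M.Letter), ((convolution w ([] : List M.Letter)).map
        Prod.snd).foldl M.secondStep .ended = .ended := by
      intro w
      induction w with
      | nil => simp [convolution]
      | cons z w ih => simpa [convolution, secondStep] using ih
    obtain rfl : s = .full := h
    simp [convolution, secondStep, key]

theorem monitorRun_eq (x : List (Option M.Letter × Option M.Letter)) : ∀ d : M.Monitor,
    M.monitorRun d x = ⟨x.foldl firstStep d.first, (x.map Prod.snd).foldl M.secondStep d.second,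
      x.foldl M.compareStep d.comparison, (x.filterMap Prod.fst).foldl M.ctStep d.ct⟩ := by
  induction x with
  | nil => exact fun d => rfl
  | cons e x ih =>
    obtain ⟨_ | a, b⟩ := e
    all_goals exact fun d => ih _

theorem monitorValid_iff (x : List (Option M.Letter × Option M.Letter)) :
    M.monitorValid (M.monitorRun M.monitorInit x) = true ↔
      ∃ (u : List M.Letter) (m : ℕ), u ≠ [] ∧ x = convolution u (M.initWord m) := by
  simp only [monitorValid, decide_eq_true_eq, monitorRun_eq, monitorInit]
  constructor
  · rintro ⟨h₁, h₂⟩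
    obtain _ | ⟨⟨_ | a, _ | b⟩, x⟩ := x
    · simp at h₁
    · simp [firstStep, foldl_firstStep_dead] at h₁
    · simp [firstStep, foldl_firstStep_dead] at h₁
    · simp [secondStep, foldl_secondStep_dead] at h₂
    · obtain ⟨u, v, rfl, h⟩ := M.exists_convolution_of_tracks x _
        (M.secondStep_some_ne_ended .start b) h₁ h₂
      obtain ⟨m, hm⟩ := (M.foldl_secondStep_start (b :: v)).1 h
      exact ⟨a :: u, m, by simp, by simp [← hm, convolution]⟩
  · rintro ⟨u, m, hu, rfl⟩
    refine ⟨?_, M.foldl_secondStep_convolution u _ _ ((M.foldl_secondStep_start _).2 ⟨m, rfl⟩)⟩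
    obtain _ | ⟨x, u⟩ := u
    · exact absurd rfl hu
    · simpa [initWord, convolution, firstStep] using foldl_firstStep_convolution u
        (M.sqr :: (List.replicate m [M.a, M.sqr]).flatten)

/-! ### The comparison of the tracks and the maximal initial prefix -/

theorem foldl_compareStep_failed (x : List (Option M.Letter × Option M.Letter)) :
    x.foldl M.compareStep .failed = .failed := by
  induction x with
  | nil => rfl
  | cons e x ih => exact ih

theorem foldl_compareStep_longer (x : List (Option M.Letter × Option M.Letter)) :
    x.foldl M.compareStep .longer = .longer := by
  induction x with
  | nil => rfl
  | cons e x ih => exact ih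

theorem foldl_compareStep_convolution : ∀ u v : List M.Letter,
    (convolution u v).foldl M.compareStep .same ≠ .failed ↔
      v <+: u ∧ ¬ v ++ [M.a] <+: u
  | [], [] => by simp [convolution]
  | x :: u, [] => by
    by_cases hx : x = M.a
    · simp [convolution, compareStep, hx, foldl_compareStep_failed]
    · simp [convolution, compareStep, hx, foldl_compareStep_longer, Ne.symm hx]
  | [], y :: v => by simp [convolution, compareStep, foldl_compareStep_failed]
  | x :: u, y :: v => by
    by_cases hx : x = y
    · simpa [convolution, compareStep, hx] using foldl_compareStep_convolution u v
    · simp [convolution, compareStep, hx, foldl_compareStep_failed, Ne.symm hx]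

/-- The word with a `□` inserted after each letter. -/
def pad (v : List M.Letter) : List M.Letter := v.flatMap (fun x => [x, M.sqr])

theorem foldl_ctStep_dead (u : List M.Letter) : u.foldl M.ctStep .dead = .dead := by
  induction u with
  | nil => rfl
  | cons x u ih => exact ih

theorem ctStep_eq_dead_or (s : M.CTState) (hs : ∀ q f e, s ≠ .block q f e true) (x : M.Letter) :
    M.ctStep s x = .dead ∨ ∃ q f e, M.ctStep s x = .block q f e true := by
  rcases s with _ | ⟨q, f, e, _ | _⟩ | _
  · cases x with
    | state p =>
      by_cases hp : p = 0
      · exact .inr ⟨_, _, _, if_pos hp⟩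
      · exact .inl (if_neg hp)
    | _ => exact .inl rfl
  · cases x with
    | box => exact .inl rfl
    | state p =>
      by_cases hp : M.nextState q e = some p
      · exact .inr ⟨_, _, _, if_pos hp⟩
      · exact .inl (if_neg hp)
    | counter c =>
      by_cases hc : f = true ∧ c ≠ 0
      · exact .inl (if_pos hc)
      · exact .inr ⟨_, _, _, if_neg hc⟩
  · exact absurd rfl (hs _ _ _)
  · exact .inl rfl

theorem ctAccept_foldl_dead (u : List M.Letter) :
    M.ctAccept (u.foldl M.ctStep .dead) = false := by
  rw [foldl_ctStep_dead]
  rfl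

/-- In a state that does not expect `□`, a letter leads to `dead` or to a state in which only `□`
avoids `dead`. So the recursion consumes two letters at a time. -/
theorem eq_pad_of_ctAccept : ∀ (u : List M.Letter) (s : M.CTState),
    (∀ q f e, s ≠ .block q f e true) → M.ctAccept (u.foldl M.ctStep s) = true →
      ∃ v, u = M.pad v
  | [], _, _, _ => ⟨[], rfl⟩
  | [x], s, hs, h => by
    rcases M.ctStep_eq_dead_or s hs x with h' | ⟨q, f, e, h'⟩ <;>
      simp only [List.foldl_cons, h'] at h <;> cases h
  | x :: y :: u, s, hs, h => by
    rw [List.foldl_cons] at h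
    rcases M.ctStep_eq_dead_or s hs x with h' | ⟨q, f, e, h'⟩
    · rw [h', ctAccept_foldl_dead] at h
      cases h
    · rw [h'] at h
      cases y with
      | box =>
        obtain ⟨v, rfl⟩ := eq_pad_of_ctAccept u (.block q f e false) (by simp) h
        exact ⟨x :: v, rfl⟩
      | _ => exact absurd ((M.ctAccept_foldl_dead u).symm.trans h) Bool.false_ne_true

theorem mem_CTreg_iff (u : List M.Letter) :
    u ∈ M.CTreg ↔ M.ctAccept (u.foldl M.ctStep .start) = true := Iff.rfl

theorem exists_pad_of_mem_CTreg {u : List M.Letter} (hu : u ∈ M.CTreg) :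
    ∃ v, v ≠ [] ∧ u = M.pad v := by
  obtain ⟨v, rfl⟩ := M.eq_pad_of_ctAccept u .start (by simp) hu
  refine ⟨v, ?_, rfl⟩
  rintro rfl
  simp [mem_CTreg_iff, pad, ctAccept] at hu

theorem initWord_add (m n : ℕ) :
    M.initWord (m + n) = M.initWord m ++ (List.replicate n [M.a, M.sqr]).flatten := by
  rw [initWord, initWord, ← List.replicate_append_replicate, List.flatten_append]
  rfl

theorem pad_append (v w : List M.Letter) : M.pad (v ++ w) = M.pad v ++ M.pad w :=
  List.flatMap_append

theorem pad_singleton (x : M.Letter) : M.pad [x] = [x, M.sqr] := rfl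

theorem initWord_eq_pad (m : ℕ) :
    M.initWord m = M.pad (M.dollar :: List.replicate m M.a) := by
  simp [initWord, pad, List.flatMap_def]

theorem pad_append_prefix_pad : ∀ (w v : List M.Letter) (x : M.Letter),
    M.pad w ++ [x] <+: M.pad v → M.pad w ++ [x, M.sqr] <+: M.pad v
  | [], [], x, h => by simp [pad] at h
  | [], y :: v, x, h => by simpa [pad] using h
  | z :: w, [], x, h => by simp [pad] at h
  | z :: w, y :: v, x, h => by
    obtain ⟨rfl, h'⟩ : z = y ∧ M.pad w ++ [x] <+: M.pad v := by simpa [pad] using h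
    simpa [pad] using pad_append_prefix_pad w v x h'

/-- Since every letter of a padded word is followed by `□`, a single further `a` already yields the
next prefix `$□(a□)^(m+1)`. This is why one letter of lookahead suffices in `compareStep`; for
unpadded words the equivalence can fail. -/
theorem isMaxInit_pad_iff (m : ℕ) (v : List M.Letter) :
    M.IsMaxInit m (M.pad v) ↔
      M.initWord m <+: M.pad v ∧ ¬ M.initWord m ++ [M.a] <+: M.pad v := by
  refine and_congr_right fun _ => ?_
  constructor
  · intro hub h
    rw [initWord_eq_pad] at h
    have h' := M.pad_append_prefix_pad _ _ _ h
    rw [← initWord_eq_pad] at h'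
    have : m + 1 ≤ m := hub (show M.initWord (m + 1) <+: _ by simpa [initWord_add] using h')
    omega
  · intro hn n hmem
    by_contra hlt
    obtain ⟨k, rfl⟩ : ∃ k, n = m + (k + 1) := ⟨n - m - 1, by simp at hlt; omega⟩
    refine hn (List.IsPrefix.trans ?_ hmem)
    rw [initWord_add]
    simp [List.replicate_succ]

theorem monitorTrace_convolution (u : List M.Letter) (m : ℕ) :
    M.monitorTrace (M.monitorRun M.monitorInit (convolution u (M.initWord m))) = true ↔
      u ∈ M.CTreg ∧ M.IsMaxInit m u := by
  rw [monitorRun_eq, monitorTrace, Bool.and_eq_true, decide_eq_true_eq, convolution_map_fst]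
  -- Membership in `CTreg` is needed for the second conjunct: it supplies the padded form.
  refine and_congr_right fun hu => ?_
  obtain ⟨v, -, rfl⟩ := M.exists_pad_of_mem_CTreg hu
  exact (M.foldl_compareStep_convolution _ _).trans (M.isMaxInit_pad_iff m v).symm

theorem convolution_ne_nil {α β : Type} {u : List α} (hu : u ≠ []) (v : List β) :
    convolution u v ≠ [] := by
  intro h
  rw [← convolution_map_fst u v, h] at hu
  exact hu rfl

/-! ### The behaviour of `autBM` in the three cases -/

theorem autBM_behaviour_of_trace {u : List M.Letter} {m : ℕ} (hu : u ≠ [])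
    (h : u ∈ M.CTreg ∧ M.IsMaxInit m u) :
    M.autBM.behaviour (convolution u (M.initWord m)) = M.autA.behaviour u := by
  refine WeightedAutomaton.behaviour_congr (Set.ext fun n => ?_)
  rw [M.mem_autBM_runWeights (convolution_ne_nil hu _), WeightedAutomaton.mem_runWeights_iff _ hu,
    (M.monitorValid_iff _).2 ⟨u, m, hu, rfl⟩, (M.monitorTrace_convolution u m).2 h,
    convolution_map_fst]
  simp

theorem autBM_behaviour_of_not_trace {u : List M.Letter} {m : ℕ} (hu : u ≠ [])
    (h : ¬ (u ∈ M.CTreg ∧ M.IsMaxInit m u)) :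
    M.autBM.behaviour (convolution u (M.initWord m)) = M.autAM.behaviour u := by
  refine WeightedAutomaton.behaviour_congr (Set.ext fun n => ?_)
  rw [M.mem_autBM_runWeights (convolution_ne_nil hu _), WeightedAutomaton.mem_runWeights_iff _ hu,
    (M.monitorValid_iff _).2 ⟨u, m, hu, rfl⟩,
    Bool.eq_false_iff.2 (mt (M.monitorTrace_convolution u m).1 h), convolution_map_fst]
  simp

theorem autBM_behaviour_of_not_valid {x : List (Option M.Letter × Option M.Letter)} (hx : x ≠ [])
    (h : ¬ ∃ (u : List M.Letter) (m : ℕ), u ≠ [] ∧ x = convolution u (M.initWord m)) :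
    M.autBM.behaviour x = 0 := by
  refine (M.autBM.behaviour_eq_coe_iff x 0).2 ?_
  have : M.autBM.runWeights x = {0} := by
    ext n
    rw [M.mem_autBM_runWeights hx, Bool.eq_false_iff.2 (mt (M.monitorValid_iff x).1 h)]
    simp
  rw [this]
  exact isGreatest_singleton

/-! ### Words of `CTreg` as sequences of configurations -/

/-- The word of a sequence of configurations, each given by its state and the list of its
counter letters. -/
def encode (t : List (M.State × List M.Counter)) : List M.Letter :=
  t.flatMap fun b => .state b.1 :: b.2.map .counter

/-- The sequence `t` of configurations has correct control states, ends in a halting state, and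
may follow a configuration with state `q` in which the tested counter is positive iff `pos`. -/
def IsTrace (M : MinskyMachine) : M.State → Bool → List (M.State × List M.Counter) → Prop
  | q, _, [] => M.instr q = .halt
  | q, pos, (p, cs) :: t => M.nextState q pos = some p ∧ M.IsTrace p (cs.any (M.tests p)) t

theorem ctAccept_foldl_counters (q : M.State) (f : Bool) (w : List M.Letter)
    (cs : List M.Counter) : ∀ s : Bool,
    M.ctAccept ((M.pad (cs.map .counter) ++ w).foldl M.ctStep (.block q f s false)) = true ↔
      (f = true → ∀ c ∈ cs, c = 0) ∧
        M.ctAccept (w.foldl M.ctStep (.block q f (s || cs.any (M.tests q)) false)) = true := by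
  induction cs with
  | nil => simp [pad]
  | cons c cs ih =>
    intro s
    by_cases hc : f = true ∧ c ≠ 0
    · refine iff_of_false ?_ fun h => hc.2 (h.1 hc.1 c (by simp))
      -- The two folds agree by computation once the condition in `ctStep` for the letter `c` is
      -- decided.
      have : (M.pad ((c :: cs).map .counter) ++ w).foldl M.ctStep (.block q f s false) =
          (M.sqr :: (M.pad (cs.map .counter) ++ w)).foldl M.ctStep .dead :=
        congrArg (List.foldl M.ctStep · (M.sqr :: (M.pad (cs.map .counter) ++ w))) (if_pos hc)
      rw [this, ctAccept_foldl_dead]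
      simp
    · have : (M.pad ((c :: cs).map .counter) ++ w).foldl M.ctStep (.block q f s false) =
          (M.pad (cs.map .counter) ++ w).foldl M.ctStep
            (.block q f (s || M.tests q c) false) :=
        congrArg (List.foldl M.ctStep · (M.sqr :: (M.pad (cs.map .counter) ++ w))) (if_neg hc)
      rw [this, ih]
      have hc' : f = true → c = 0 := by tauto
      simp only [List.any_cons, Bool.or_assoc, List.forall_mem_cons]
      tauto

theorem ctAccept_foldl_state (q p : M.State) (f s : Bool) (w : List M.Letter) :
    M.ctAccept ((M.pad [.state p] ++ w).foldl M.ctStep (.block q f s false)) = true ↔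
      M.nextState q s = some p ∧
        M.ctAccept (w.foldl M.ctStep (.block p false false false)) = true := by
  by_cases hp : M.nextState q s = some p
  · have : (M.pad [.state p] ++ w).foldl M.ctStep (.block q f s false) =
        w.foldl M.ctStep (.block p false false false) :=
      congrArg (List.foldl M.ctStep · (M.sqr :: w)) (if_pos hp)
    rw [this, and_iff_right hp]
  · have : (M.pad [.state p] ++ w).foldl M.ctStep (.block q f s false) =
        (M.sqr :: w).foldl M.ctStep .dead :=
      congrArg (List.foldl M.ctStep · (M.sqr :: w)) (if_neg hp)
    rw [this, ctAccept_foldl_dead]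
    simp [hp]

theorem ctAccept_foldl_encode (t : List (M.State × List M.Counter)) : ∀ (q : M.State)
    (f s : Bool), M.ctAccept ((M.pad (M.encode t)).foldl M.ctStep (.block q f s false)) = true ↔
      M.IsTrace q s t := by
  induction t with
  | nil => simp [encode, pad, ctAccept, IsTrace]
  | cons b t ih =>
    obtain ⟨p, cs⟩ := b
    intro q f s
    have : M.pad (M.encode ((p, cs) :: t)) =
        M.pad [.state p] ++ (M.pad (cs.map .counter) ++ M.pad (M.encode t)) := by
      simp [encode, pad]
    rw [this, ctAccept_foldl_state, ctAccept_foldl_counters, ih]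
    simp [IsTrace]

theorem exists_eq_encode (v : List M.Letter) : ∀ (q : M.State) (f s : Bool),
    M.ctAccept ((M.pad v).foldl M.ctStep (.block q f s false)) = true →
      ∃ (cs : List M.Counter) (t : List (M.State × List M.Counter)),
        v = cs.map .counter ++ M.encode t := by
  induction v with
  | nil => exact fun _ _ _ _ => ⟨[], [], rfl⟩
  | cons x v ih =>
    intro q f s h
    have h' : M.ctAccept ((M.pad [x] ++ M.pad v).foldl M.ctStep (.block q f s false)) = true := by
      rwa [← pad_append]
    cases x with
    | box => exact absurd ((M.ctAccept_foldl_dead _).symm.trans h) Bool.false_ne_true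
    | state p =>
      obtain ⟨cs, t, rfl⟩ := ih _ _ _ ((M.ctAccept_foldl_state q p f s _).1 h').2
      exact ⟨[], (p, cs) :: t, by simp [encode]⟩
    | counter c =>
      obtain ⟨cs, t, rfl⟩ := ih _ _ _ ((M.ctAccept_foldl_counters q f _ [c] s).1 h').2
      exact ⟨c :: cs, t, by simp⟩

theorem ctAccept_foldl_start (v : List M.Letter) :
    M.ctAccept ((M.pad v).foldl M.ctStep .start) = true ↔
      ∃ w, v = M.dollar :: w ∧
        M.ctAccept ((M.pad w).foldl M.ctStep (.block 0 true false false)) = true := by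
  obtain _ | ⟨_ | q | c, v⟩ := v
  · simp [pad, ctAccept]
  · refine iff_of_false ?_ (by simp)
    exact fun h => absurd ((M.ctAccept_foldl_dead _).symm.trans h) Bool.false_ne_true
  · by_cases hq : q = 0
    · subst hq
      simp only [List.cons.injEq, true_and, exists_eq_left']
      rfl
    · refine iff_of_false ?_ (by simp [hq])
      have : (M.pad (.state q :: v)).foldl M.ctStep .start =
          (M.sqr :: M.pad v).foldl M.ctStep .dead :=
        congrArg (List.foldl M.ctStep · (M.sqr :: M.pad v)) (if_neg hq)
      rw [this, ctAccept_foldl_dead]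
      simp
  · refine iff_of_false ?_ (by simp)
    exact fun h => absurd ((M.ctAccept_foldl_dead _).symm.trans h) Bool.false_ne_true

theorem initWord_append_encode (k : ℕ) (t : List (M.State × List M.Counter)) :
    M.initWord k ++ M.pad (M.encode t) = M.pad (M.encode ((0, List.replicate k 0) :: t)) := by
  rw [initWord_eq_pad, ← pad_append]
  simp [encode]

theorem mem_CTreg_iff_exists (u : List M.Letter) :
    u ∈ M.CTreg ↔ ∃ k t, u = M.pad (M.encode ((0, List.replicate k 0) :: t)) ∧
      M.IsTrace 0 ((List.replicate k 0).any (M.tests 0)) t := by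
  constructor
  · intro hu
    obtain ⟨v, -, rfl⟩ := M.exists_pad_of_mem_CTreg hu
    obtain ⟨w, rfl, h⟩ := (M.ctAccept_foldl_start v).1 hu
    obtain ⟨cs, t, rfl⟩ := M.exists_eq_encode w _ _ _ h
    rw [pad_append, ctAccept_foldl_counters, ctAccept_foldl_encode, Bool.false_or] at h
    have hcs : cs = List.replicate cs.length 0 := List.eq_replicate_iff.2 ⟨rfl, h.1 rfl⟩
    refine ⟨cs.length, t, ?_, ?_⟩
    · rw [← hcs]
      simp [encode]
    · rw [← hcs]
      exact h.2
  · rintro ⟨k, t, rfl, h⟩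
    refine (M.ctAccept_foldl_start _).2 ⟨(List.replicate k 0).map .counter ++ M.encode t,
      by simp [encode], ?_⟩
    rw [pad_append, ctAccept_foldl_counters, ctAccept_foldl_encode]
    exact ⟨fun _ c hc => (List.mem_replicate.1 hc).2, h⟩

/-- After the `k` letters `a` the word ends or continues with a state letter, never with another
`a`. -/
theorem isMaxInit_encode (k : ℕ) (t : List (M.State × List M.Counter)) :
    M.IsMaxInit k (M.pad (M.encode ((0, List.replicate k 0) :: t))) := by
  rw [isMaxInit_pad_iff, ← initWord_append_encode]
  refine ⟨List.prefix_append _ _, ?_⟩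
  rw [List.prefix_append_right_inj]
  obtain _ | ⟨b, t⟩ := t <;> simp [encode, pad]

/-! ### Genuine computations and acceptance -/

/-- The change of counter `c` under the instruction of `q`, where `pos` tells whether `c` is
positive. -/
def change (q : M.State) (c : M.Counter) (pos : Bool) : ℤ :=
  match M.instr q with
  | .inc c' _ => if c' = c then 1 else 0
  | .dec c' _ _ => if c' = c ∧ pos = true then -1 else 0
  | .halt => 0

/-- A correct step splits into the part checked by `CTreg` (the control state, given the zero test)
and one numerical equation per counter, the part left to `autA`. The equations are over `ℤ`;
truncated subtraction in `step` does no harm, as it occurs only at a positive value. -/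
theorem step_eq_some_iff (q p : M.State) (cs cs' : List M.Counter) :
    M.step (q, fun c => cs.count c) = some (p, fun c => cs'.count c) ↔
      M.nextState q (cs.any (M.tests q)) = some p ∧
        ∀ c, (cs'.count c : ℤ) = cs.count c + M.change q c (decide (c ∈ cs)) := by
  unfold step nextState change
  cases hq : M.instr q with
  | inc c p' =>
    simp only [Option.some.injEq, Prod.mk.injEq, funext_iff, Function.update_apply]
    refine and_congr_right fun _ => forall_congr' fun c' => ?_
    by_cases h : c' = c
    · subst h
      simp only [if_true]
      omega
    · simp only [if_neg h, if_neg (Ne.symm h)]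
      omega
  | dec c p' z =>
    have ht : cs.any (M.tests q) = decide (c ∈ cs) := by
      rw [Bool.eq_iff_iff, List.any_eq_true, decide_eq_true_eq]
      simp only [tests, hq, decide_eq_true_eq]
      exact ⟨fun ⟨x, hx, e⟩ => e ▸ hx, fun h => ⟨c, h, rfl⟩⟩
    by_cases hc : c ∈ cs
    · have hpos : cs.count c ≠ 0 := (List.count_pos_iff.2 hc).ne'
      simp only [ht, hc, decide_true, if_true, if_neg hpos, Option.some.injEq, Prod.mk.injEq,
        funext_iff, Function.update_apply]
      refine and_congr_right fun _ => forall_congr' fun c' => ?_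
      by_cases h : c' = c
      · subst h
        simp only [hc, decide_true, and_self, if_true]
        omega
      · simp only [if_neg h, Ne.symm h, false_and, if_false]
        omega
    · have hpos : cs.count c = 0 := List.count_eq_zero.2 hc
      simp only [ht, hc, decide_false, if_pos hpos, Option.some.injEq, Prod.mk.injEq,
        funext_iff]
      refine and_congr (by simp) (forall_congr' fun c' => ?_)
      by_cases h : c' = c
      · subst h
        simp [hc]
        omega
      · simp only [Ne.symm h, false_and, if_false]
        omega
  | halt => simp

/-- The sequence of configurations `(q, cs) :: t` is a halting computation. -/
def IsComputation (M : MinskyMachine) :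
    M.State → List M.Counter → List (M.State × List M.Counter) → Prop
  | q, _, [] => M.instr q = .halt
  | q, cs, (p, cs') :: t =>
      M.step (q, fun c => cs.count c) = some (p, fun c => cs'.count c) ∧ M.IsComputation p cs' t

theorem IsComputation.isTrace {M : MinskyMachine} : ∀ {t : List (M.State × List M.Counter)}
    {q : M.State} {cs : List M.Counter}, M.IsComputation q cs t →
      M.IsTrace q (cs.any (M.tests q)) t
  | [], _, _, h => h
  | (_, _) :: _, _, _, h => ⟨((M.step_eq_some_iff _ _ _ _).1 h.1).1, h.2.isTrace⟩

theorem IsComputation.exists_halt {M : MinskyMachine} :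
    ∀ {t : List (M.State × List M.Counter)} {q : M.State} {cs : List M.Counter},
      M.IsComputation q cs t → ∃ κ : M.Config,
        Relation.ReflTransGen (fun κ₁ κ₂ => M.step κ₁ = some κ₂) (q, fun c => cs.count c) κ ∧
          M.instr κ.1 = .halt
  | [], _, _, h => ⟨_, .refl, h⟩
  | (_, _) :: _, _, _, h => by
    obtain ⟨κ, hκ, hh⟩ := h.2.exists_halt
    exact ⟨κ, .head h.1 hκ, hh⟩

theorem exists_count_eq (g : M.Counter → ℕ) : ∃ cs : List M.Counter, (fun c => cs.count c) = g := by
  refine ⟨(Finsupp.equivFunOnFinite.symm g).toMultiset.toList, funext fun c => ?_⟩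
  rw [← Multiset.coe_count, Multiset.coe_toList, Finsupp.count_toMultiset]
  rfl

/-- Counter letters may occur in any order, so each configuration along the computation can be
represented by some list with the right multiplicities. -/
theorem exists_isComputation {κ₀ κ : M.Config}
    (h : Relation.ReflTransGen (fun κ₁ κ₂ => M.step κ₁ = some κ₂) κ₀ κ)
    (hh : M.instr κ.1 = .halt) : ∀ cs : List M.Counter, (fun c => cs.count c) = κ₀.2 →
      ∃ t, M.IsComputation κ₀.1 cs t := by
  induction h using Relation.ReflTransGen.head_induction_on with
  | refl => exact fun cs _ => ⟨[], hh⟩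
  | head hs _ ih =>
    rename_i κ₁ κ₂ _
    intro cs hcs
    obtain ⟨cs', hcs'⟩ := M.exists_count_eq κ₂.2
    obtain ⟨t, ht⟩ := ih cs' hcs'
    exact ⟨(κ₂.1, cs') :: t, by rw [hcs, hcs']; exact hs, ht⟩

theorem initial_eq (m : ℕ) :
    M.initial m = (0, fun c => (List.replicate m (0 : M.Counter)).count c) := by
  refine Prod.ext rfl (funext fun c => ?_)
  change (M.initial m).2 c = (List.replicate m (0 : M.Counter)).count c
  rw [List.count_replicate]
  by_cases hc : c = 0
  · subst hc
    simp [initial]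
  · simp [initial, hc, Ne.symm hc]

theorem accepts_iff (m : ℕ) :
    M.Accepts m ↔ ∃ t, M.IsComputation 0 (List.replicate m 0) t := by
  constructor
  · rintro ⟨κ, h, hh⟩
    exact M.exists_isComputation h hh _ (by rw [initial_eq])
  · rintro ⟨t, ht⟩
    obtain ⟨κ, h, hh⟩ := ht.exists_halt
    exact ⟨κ, by rwa [initial_eq], hh⟩

/-! ### The weights of the runs of `autA` -/

/-- The state and the weight reached by the deterministic transitions of `A`. -/
def errRun (M : MinskyMachine) : M.ErrState → List M.Letter → M.ErrState × ℕ
  | s, [] => (s, 0)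
  | s, x :: w => ((M.errRun (M.errNext s x).1 w).1,
      (M.errNext s x).2 + (M.errRun (M.errNext s x).1 w).2)

theorem errRun_append (v w : List M.Letter) : ∀ s, M.errRun s (v ++ w) =
    ((M.errRun (M.errRun s v).1 w).1, (M.errRun s v).2 + (M.errRun (M.errRun s v).1 w).2) := by
  induction v with
  | nil => simp [errRun]
  | cons x v ih =>
    intro s
    simp only [List.cons_append, errRun, ih, add_assoc]

theorem autA_reaches_errRun (w : List M.Letter) : ∀ s : M.ErrState,
    M.autA.Reaches s w (M.errRun s w).2 (M.errRun s w).1 := by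
  induction w with
  | nil => exact fun s => ⟨rfl, rfl⟩
  | cons x w ih => exact fun s => ⟨_, _, _, if_pos rfl, ih _, rfl⟩

theorem autA_weight_eq_coe (s t : M.ErrState) (x : M.Letter) (k : Fin 2) :
    M.autA.weight s x t = (k : WithBot (Fin 2)) ↔
      (t = (M.errNext s x).1 ∧ k = (M.errNext s x).2) ∨
      (t ≠ (M.errNext s x).1 ∧ M.errGuess s x t = true ∧ k = 1) := by
  simp only [autA]
  split_ifs with h₁ h₂
  · rw [WithBot.coe_inj, eq_comm]
    simp [h₁]
  · rw [WithBot.coe_inj, eq_comm]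
    simp [h₁, h₂]
  · simp [h₁, h₂]

theorem errNext_ne_idle {s : M.ErrState} (hs : s ≠ .idle) (x : M.Letter) :
    (M.errNext s x).1 ≠ .idle := by
  cases s <;> cases x <;> simp [errNext] at hs ⊢ <;> split_ifs <;> simp

theorem errGuess_eq_false {s : M.ErrState} (hs : s ≠ .idle) (x : M.Letter) (t : M.ErrState) :
    M.errGuess s x t = false := by
  cases s <;> first | exact absurd rfl hs | rfl

/-- The only nondeterminism of `autA` is the guess made in `idle`, and `idle` is never entered
again. -/
theorem autA_reaches_iff_errRun (w : List M.Letter) : ∀ {s : M.ErrState}, s ≠ .idle →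
    ∀ (n : ℕ) (f : M.ErrState), M.autA.Reaches s w n f ↔ M.errRun s w = (f, n) := by
  induction w with
  | nil =>
    intro s _ n f
    rw [errRun, Prod.mk.injEq, eq_comm (b := n)]
    rfl
  | cons x w ih =>
    intro s hs n f
    constructor
    · rintro ⟨t, k, n', hk, hr, rfl⟩
      have hk' := (M.autA_weight_eq_coe _ _ _ _).1 hk
      obtain ⟨rfl, rfl⟩ := hk'.resolve_right fun h =>
        Bool.false_ne_true ((M.errGuess_eq_false hs x t).symm.trans h.2.1)
      simp only [errRun, (ih (M.errNext_ne_idle hs x) _ _).1 hr]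
    · intro h
      have := M.autA_reaches_errRun (x :: w) s
      rwa [h] at this

theorem pad_cons (x : M.Letter) (v : List M.Letter) : M.pad (x :: v) = x :: M.sqr :: M.pad v := rfl

theorem length_pad (v : List M.Letter) : (M.pad v).length = 2 * v.length := by
  simp [pad, mul_comm]

theorem box_notMem_encode (t : List (M.State × List M.Counter)) : Letter.box ∉ M.encode t := by
  simp [encode]

theorem length_encode_cons (p : M.State) (cs : List M.Counter)
    (t : List (M.State × List M.Counter)) :
    (M.encode ((p, cs) :: t)).length = 1 + cs.length + (M.encode t).length := by
  simp [encode]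
  omega

theorem encode_cons (p : M.State) (cs : List M.Counter) (t : List (M.State × List M.Counter)) :
    M.encode ((p, cs) :: t) = .state p :: (cs.map .counter ++ M.encode t) := rfl

theorem errRun_done (v : List M.Letter) (hv : Letter.box ∉ v) :
    M.errRun .done (M.pad v) = (.done, v.length) := by
  induction v with
  | nil => rfl
  | cons x v ih =>
    rw [pad_cons]
    cases x with
    | box => simp at hv
    | _ =>
      simp only [errRun, errNext, ih fun h => hv (List.mem_cons_of_mem _ h)]
      simp [add_comm]

/-- The sign with which a value that is too large contributes to the weight of the first
configuration of a comparison. -/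
def sgn (l : Bool) : ℤ := if l then 1 else -1

/-- A pair `c□` weighs `1 + sgn l`, that is 2 or 0, and every other pair weighs 1. Weight 2 is split
between the letter and its `□`, since one transition weighs at most 1. -/
theorem errRun_first_counters (c : M.Counter) (l : Bool) (q : M.State) (cs : List M.Counter) :
    ∀ s : Bool,
      (M.errRun (.first c l q s false) (M.pad (cs.map .counter))).1 =
        .first c l q (s || decide (c ∈ cs)) false ∧
      ((M.errRun (.first c l q s false) (M.pad (cs.map .counter))).2 : ℤ) =
        cs.length + sgn l * cs.count c := by
  induction cs with
  | nil => simp [pad, errRun]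
  | cons c' cs ih =>
    intro s
    rw [List.map_cons, pad_cons]
    by_cases hc : c' = c
    · subst hc
      simp only [errRun, errNext, if_true, ih true]
      cases l <;> simp [sgn, ih true]
      all_goals ring
    · simp only [errRun, errNext, if_neg hc, ih s]
      refine ⟨by simp [Ne.symm hc], ?_⟩
      simp [hc, ih s]
      ring

/-- The sign is opposite to that in the first configuration, so equal numbers of occurrences cancel.
-/
theorem errRun_second_counters (c : M.Counter) (l : Bool) (cs : List M.Counter) :
    (M.errRun (.second c l false) (M.pad (cs.map .counter))).1 = .second c l false ∧
      ((M.errRun (.second c l false) (M.pad (cs.map .counter))).2 : ℤ) =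
        cs.length - sgn l * cs.count c := by
  induction cs with
  | nil => simp [pad, errRun]
  | cons c' cs ih =>
    rw [List.map_cons, pad_cons]
    by_cases hc : c' = c
    · subst hc
      simp only [errRun, errNext, if_true, ih]
      cases l <;> simp [sgn, ih]
      all_goals ring
    · simp only [errRun, errNext, if_neg hc, ih]
      refine ⟨by simp, ?_⟩
      simp [hc, ih]
      ring

theorem delta_eq (c : M.Counter) (l : Bool) (q : M.State) (s : Bool) :
    (M.delta c l q s : ℤ) = 1 + sgn l * M.change q c s := by
  unfold delta change sgn
  cases M.instr q <;> cases l <;> simp only [] <;> split_ifs <;> simp_all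

/-- The state letter between the two configurations carries the prescribed change, normalised by
`delta` to the range 0, 1, 2 of a pair. -/
theorem errRun_first_state (c : M.Counter) (l : Bool) (q p : M.State) (s : Bool) :
    M.errRun (.first c l q s false) (M.pad [.state p]) = (.second c l false, M.delta c l q s) := by
  have : M.delta c l q s = 0 ∨ M.delta c l q s = 1 ∨ M.delta c l q s = 2 := by
    unfold delta
    cases M.instr q with
    | halt => simp
    | _ =>
      simp only []
      split_ifs <;> simp
  rw [pad_singleton]
  rcases this with h | h | h <;> simp [errRun, errNext, h]

theorem errRun_second_encode (c : M.Counter) (l : Bool) (t : List (M.State × List M.Counter)) :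
    M.errFinal (M.errRun (.second c l false) (M.pad (M.encode t))).1 = true ∧
      (M.errRun (.second c l false) (M.pad (M.encode t))).2 = (M.encode t).length := by
  obtain _ | ⟨⟨p, cs⟩, t⟩ := t
  · exact ⟨rfl, rfl⟩
  · have h := M.box_notMem_encode ((p, cs) :: t)
    rw [encode_cons] at h
    rw [encode_cons, pad_cons]
    simp only [errRun, errNext, M.errRun_done _ fun h' => h (List.mem_cons_of_mem _ h')]
    refine ⟨rfl, ?_⟩
    simp
    omega

/-- The weight of a comparison of two consecutive configurations. -/
theorem errRun_first (c : M.Counter) (l : Bool) (q p : M.State) (cs cs' : List M.Counter)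
    (t : List (M.State × List M.Counter)) :
    M.errFinal (M.errRun (.first c l q false false)
        (M.pad (cs.map .counter ++ M.encode ((p, cs') :: t)))).1 = true ∧
      ((M.errRun (.first c l q false false)
        (M.pad (cs.map .counter ++ M.encode ((p, cs') :: t)))).2 : ℤ) =
        cs.length + (M.encode ((p, cs') :: t)).length +
          sgn l * (cs.count c + M.change q c (decide (c ∈ cs)) - cs'.count c) := by
  have h : M.pad (cs.map .counter ++ M.encode ((p, cs') :: t)) =
      M.pad (cs.map .counter) ++ (M.pad [.state p] ++
        (M.pad (cs'.map .counter) ++ M.pad (M.encode t))) := by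
    simp only [← pad_append]
    rfl
  obtain ⟨h₁, h₁'⟩ := M.errRun_first_counters c l q cs false
  obtain ⟨h₂, h₂'⟩ := M.errRun_second_counters c l cs'
  obtain ⟨h₃, h₃'⟩ := M.errRun_second_encode c l t
  rw [h, length_encode_cons]
  simp only [errRun_append, h₁, errRun_first_state, h₂, h₃']
  refine ⟨h₃, ?_⟩
  push_cast
  rw [h₁', h₂', delta_eq, Bool.false_or]
  ring

theorem autA_reaches_idle_not_state {x : M.Letter} (hx : ∀ q, x ≠ .state q) (w : List M.Letter)
    (n : ℕ) (f : M.ErrState) : M.autA.Reaches .idle (x :: w) n f ↔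
      ∃ n', M.autA.Reaches .idle w n' f ∧ n = (M.errNext .idle x).2 + n' := by
  have h₁ : (M.errNext .idle x).1 = .idle := by cases x <;> rfl
  have h₂ : ∀ t, M.errGuess .idle x t = false := by
    intro t
    cases x with
    | state q => exact absurd rfl (hx q)
    | _ => rfl
  constructor
  · rintro ⟨t, k, n', hk, hr, rfl⟩
    have hk' := (M.autA_weight_eq_coe _ _ _ _).1 hk
    obtain ⟨rfl, rfl⟩ := hk'.resolve_right fun h =>
      Bool.false_ne_true ((h₂ t).symm.trans h.2.1)
    exact ⟨n', h₁ ▸ hr, rfl⟩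
  · rintro ⟨n', hr, rfl⟩
    exact ⟨.idle, _, n', (M.autA_weight_eq_coe _ _ _ _).2 (.inl ⟨h₁.symm, rfl⟩), hr, rfl⟩

theorem autA_reaches_idle_counters (cs : List M.Counter) (w : List M.Letter) : ∀ (n : ℕ)
    (f : M.ErrState), M.autA.Reaches .idle (M.pad (cs.map .counter ++ w)) n f ↔
      ∃ n', M.autA.Reaches .idle (M.pad w) n' f ∧ n = cs.length + n' := by
  induction cs with
  | nil => simp
  | cons c cs ih =>
    intro n f
    rw [List.map_cons, List.cons_append, pad_cons, autA_reaches_idle_not_state _ (by simp)]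
    simp only [M.autA_reaches_idle_not_state (x := M.sqr) (by simp), ih]
    constructor
    · rintro ⟨_, ⟨_, ⟨n', hr, rfl⟩, rfl⟩, rfl⟩
      refine ⟨n', hr, ?_⟩
      simp [errNext]
      omega
    · rintro ⟨n', hr, rfl⟩
      refine ⟨_, ⟨_, ⟨n', hr, rfl⟩, rfl⟩, ?_⟩
      simp [errNext]
      omega

theorem autA_reaches_idle_state (q : M.State) (w : List M.Letter) (n : ℕ) (f : M.ErrState) :
    M.autA.Reaches .idle (M.pad (.state q :: w)) n f ↔
      (∃ n', M.autA.Reaches .idle (M.pad w) n' f ∧ n = 1 + n') ∨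
      ∃ c l n', M.errRun (.first c l q false false) (M.pad w) = (f, n') ∧ n = 1 + n' := by
  have h (t : M.ErrState) (k : Fin 2) : M.autA.weight .idle (.state q) t = (k : WithBot (Fin 2)) ↔
      (t = .idle ∨ ∃ c l, t = .first c l q false false) ∧ k = 1 := by
    rw [autA_weight_eq_coe]
    rcases t with _ | ⟨c, l, q', _ | _, _ | _⟩ | _ | _ <;>
      simp [errNext, errGuess]
  have h' (c l n') (f : M.ErrState) :
      M.autA.Reaches (.first c l q false false) (M.sqr :: M.pad w) n' f ↔
      M.errRun (.first c l q false false) (M.pad w) = (f, n') := by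
    refine (M.autA_reaches_iff_errRun _ (by simp) _ _).trans ?_
    simp [errRun, errNext]
  rw [pad_cons]
  constructor
  · rintro ⟨t, k, n', hk, hr, rfl⟩
    obtain ⟨rfl | ⟨c, l, rfl⟩, rfl⟩ := (h t k).1 hk
    · obtain ⟨n', hr', rfl⟩ := (M.autA_reaches_idle_not_state (x := M.sqr) (by simp) _ _ _).1 hr
      exact .inl ⟨n', hr', by simp [errNext]⟩
    · exact .inr ⟨c, l, n', (h' _ _ _ _).1 hr, rfl⟩
  · rintro (⟨n', hr, rfl⟩ | ⟨c, l, n', hr, rfl⟩)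
    · exact ⟨.idle, 1, n', (h _ _).2 ⟨.inl rfl, rfl⟩,
        (M.autA_reaches_idle_not_state (x := M.sqr) (by simp) _ _ _).2
          ⟨n', hr, by simp [errNext]⟩, rfl⟩
    · exact ⟨_, 1, n', (h _ _).2 ⟨.inr ⟨c, l, rfl⟩, rfl⟩, (h' _ _ _ _).2 hr, rfl⟩

/-- A run either idles through the whole first configuration or starts its comparison there. This is
the recursion for the induction on the number of configurations. -/
theorem autA_reaches_idle_encode_cons (q : M.State) (cs : List M.Counter)
    (t : List (M.State × List M.Counter)) (n : ℕ) (f : M.ErrState) :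
    M.autA.Reaches .idle (M.pad (M.encode ((q, cs) :: t))) n f ↔
      (∃ n', M.autA.Reaches .idle (M.pad (M.encode t)) n' f ∧ n = 1 + cs.length + n') ∨
      ∃ c l n', M.errRun (.first c l q false false)
        (M.pad (cs.map .counter ++ M.encode t)) = (f, n') ∧ n = 1 + n' := by
  rw [encode_cons, autA_reaches_idle_state]
  simp only [autA_reaches_idle_counters]
  refine or_congr_left ⟨?_, ?_⟩
  · rintro ⟨_, ⟨n', hr, rfl⟩, rfl⟩
    exact ⟨n', hr, by omega⟩
  · rintro ⟨n', hr, rfl⟩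
    exact ⟨_, ⟨n', hr, rfl⟩, by omega⟩

/-! ### Excess weight detects wrong computations -/

theorem IsComputation.weight_le {M : MinskyMachine} : ∀ {t : List (M.State × List M.Counter)}
    {q : M.State} {cs : List M.Counter}, M.IsComputation q cs t →
      ∀ {n : ℕ} {f : M.ErrState}, M.errFinal f = true →
        M.autA.Reaches .idle (M.pad (M.encode ((q, cs) :: t))) n f →
          n ≤ (M.encode ((q, cs) :: t)).length
  | [], q, cs, _, n, f, hf, hr => by
    rcases (M.autA_reaches_idle_encode_cons q cs [] n f).1 hr with
      ⟨n', ⟨-, rfl⟩, rfl⟩ | ⟨c, l, n', he, rfl⟩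
    · rw [length_encode_cons]
      omega
    -- A guess in the last configuration has nothing to compare with: the run ends in a `first`
    -- state, which is not accepting.
    · rw [show M.encode [] = [] from rfl, List.append_nil] at he
      have h₁ := (M.errRun_first_counters c l q cs false).1
      rw [he] at h₁
      rw [show f = _ from h₁] at hf
      cases hf
  | (p, cs') :: t, q, cs, h, n, f, hf, hr => by
    rw [length_encode_cons]
    rcases (M.autA_reaches_idle_encode_cons q cs _ n f).1 hr with
      ⟨n', hr', rfl⟩ | ⟨c, l, n', he, rfl⟩
    · have := h.2.weight_le hf hr'
      omega
    · have h₁ := (M.errRun_first c l q p cs cs' t).2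
      -- The step is correct, so the difference in the weight formula of `errRun_first` vanishes.
      rw [he, ← ((M.step_eq_some_iff _ _ _ _).1 h.1).2 c, sub_self, mul_zero] at h₁
      simp only at h₁
      omega

theorem IsTrace.isComputation {M : MinskyMachine} : ∀ {t : List (M.State × List M.Counter)}
    {q : M.State} {cs : List M.Counter}, M.IsTrace q (cs.any (M.tests q)) t →
      (∀ (n : ℕ) (f : M.ErrState), M.errFinal f = true →
        M.autA.Reaches .idle (M.pad (M.encode ((q, cs) :: t))) n f →
          n ≤ (M.encode ((q, cs) :: t)).length) →
      M.IsComputation q cs t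
  | [], _, _, h, _ => h
  | (p, cs') :: t, q, cs, h, hle => by
    simp only [autA_reaches_idle_encode_cons _ q cs] at hle
    rw [length_encode_cons] at hle
    refine ⟨(M.step_eq_some_iff _ _ _ _).2 ⟨h.1, fun c => ?_⟩, h.2.isComputation ?_⟩
    -- Comparisons of both signs are accepting runs, so the difference is at most 0 and at least 0.
    · have key (l : Bool) :
          sgn l * (cs.count c + M.change q c (decide (c ∈ cs)) - cs'.count c) ≤ 0 := by
        obtain ⟨h₁, h₂⟩ := M.errRun_first c l q p cs cs' t
        have := hle _ _ h₁ (.inr ⟨c, l, _, rfl, rfl⟩)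
        omega
      have h₁ := key true
      have h₂ := key false
      simp only [sgn] at h₁ h₂
      simp at h₁ h₂
      omega
    -- A run on the tail extends by idling through the first configuration, which raises weight and
    -- bound equally.
    · intro n f hf hr
      have := hle _ f hf (.inl ⟨n, hr, rfl⟩)
      omega

theorem exists_autA_behaviour_eq_coe {u : List M.Letter} (hu : u ≠ []) :
    ∃ n : ℕ, M.autA.behaviour u = (n : WithBot ℕ) := by
  refine WeightedAutomaton.exists_behaviour_eq_coe
    ⟨_, (M.autA.mem_runWeights_iff hu).2 ⟨_, ?_, M.autA_reaches_errRun u .idle⟩⟩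
  -- The run that never guesses exists on every word and stays in `idle`, which is accepting.
  have : ∀ w : List M.Letter, (M.errRun .idle w).1 = .idle := by
    intro w
    induction w with
    | nil => rfl
    | cons x w ih => cases x <;> exact ih
  rw [this]
  rfl

/-! ### The two characterisations of acceptance -/

theorem pad_encode_cons_ne_nil (q : M.State) (cs : List M.Counter)
    (t : List (M.State × List M.Counter)) : M.pad (M.encode ((q, cs) :: t)) ≠ [] := by
  simp [encode_cons, pad_cons]

theorem not_accepts_iff (m : ℕ) : ¬ M.Accepts m ↔
    ∀ u ∈ M.CTreg, M.IsMaxInit m u →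
      ∃ n : ℕ, M.autA.behaviour u = (n : WithBot ℕ) ∧ (u.length : ℚ) / 2 < n := by
  have half (v : List M.Letter) (n : ℕ) : ((M.pad v).length : ℚ) / 2 < n ↔ v.length < n := by
    rw [length_pad, Nat.cast_mul, Nat.cast_ofNat, mul_div_cancel_left₀ _ two_ne_zero, Nat.cast_lt]
  constructor
  · intro hm u hu hmax
    obtain ⟨k, t, rfl, ht⟩ := (M.mem_CTreg_iff_exists u).1 hu
    -- The number of input letters in the first configuration is the maximal prefix exponent, hence
    -- the given input.
    obtain rfl : k = m := (M.isMaxInit_encode k t).unique hmax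
    obtain ⟨n, hn⟩ := M.exists_autA_behaviour_eq_coe (M.pad_encode_cons_ne_nil _ _ t)
    refine ⟨n, hn, (half _ _).2 ?_⟩
    by_contra hle
    refine hm ((M.accepts_iff k).2 ⟨t, ht.isComputation fun n' f hf hr => ?_⟩)
    have := ((M.autA.behaviour_eq_coe_iff _ _).1 hn).2
      ((M.autA.mem_runWeights_iff (M.pad_encode_cons_ne_nil _ _ t)).2 ⟨f, hf, hr⟩)
    omega
  · intro h hm
    obtain ⟨t, ht⟩ := (M.accepts_iff m).1 hm
    obtain ⟨n, hn, hlt⟩ := h _ ((M.mem_CTreg_iff_exists _).2 ⟨m, t, rfl, ht.isTrace⟩)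
      (M.isMaxInit_encode m t)
    obtain ⟨f, hf, hr⟩ := (M.autA.mem_runWeights_iff (M.pad_encode_cons_ne_nil _ _ t)).1
      ((M.autA.behaviour_eq_coe_iff _ _).1 hn).1
    exact ((half _ _).1 hlt).not_ge (ht.weight_le hf hr)

theorem autAM_behaviour {u : List M.Letter} (hu : u ≠ []) :
    M.autAM.behaviour u = max ((u.length / 2 + 1 : ℕ) : WithBot ℕ) (M.autA.behaviour u) :=
  M.autA.maxHalf_behaviour hu

theorem exists_r_eq_coe (m : ℕ) {u : List M.Letter} (hu : u ≠ []) :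
    ∃ n : ℕ, M.r m u = (n : WithBot ℕ) := by
  obtain ⟨n, hn⟩ := M.exists_autA_behaviour_eq_coe hu
  by_cases h : u ∈ M.CTreg ∧ M.IsMaxInit m u
  · exact ⟨n, (M.autBM_behaviour_of_trace hu h).trans hn⟩
  · refine ⟨max (u.length / 2 + 1) n, (M.autBM_behaviour_of_not_trace hu h).trans ?_⟩
    rw [M.autAM_behaviour hu, hn]
    rfl

theorem not_accepts_iff_behaviour_eq (m : ℕ) : ¬ M.Accepts m ↔
    ∀ u : List M.Letter, u ≠ [] → M.autAM.behaviour u = M.r m u := by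
  -- For a natural number, exceeding `k / 2` in `ℚ` means reaching the rounded-down half plus 1,
  -- which is the value added by `maxHalf`.
  have half (k n : ℕ) : (k : ℚ) / 2 < n ↔ k / 2 + 1 ≤ n := by
    rw [div_lt_iff₀ two_pos]
    norm_cast
    omega
  have key {u : List M.Letter} (hu : u ≠ []) : M.autAM.behaviour u = M.autA.behaviour u ↔
      ∃ n : ℕ, M.autA.behaviour u = (n : WithBot ℕ) ∧ (u.length : ℚ) / 2 < n := by
    obtain ⟨n, hn⟩ := M.exists_autA_behaviour_eq_coe hu
    rw [M.autAM_behaviour hu, hn, max_eq_right_iff]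
    constructor
    · exact fun h => ⟨n, rfl, (half _ _).2 (WithBot.coe_le_coe.1 h)⟩
    · rintro ⟨n', hn', h⟩
      exact WithBot.coe_le_coe.2 ((WithBot.coe_injective hn') ▸ (half _ _).1 h)
  rw [not_accepts_iff]
  constructor
  · intro h u hu
    by_cases hu' : u ∈ M.CTreg ∧ M.IsMaxInit m u
    · exact ((key hu).2 (h u hu'.1 hu'.2)).trans (M.autBM_behaviour_of_trace hu hu').symm
    · exact (M.autBM_behaviour_of_not_trace hu hu').symm
  · intro h u hu hmax
    have hne : u ≠ [] := by
      obtain ⟨v, hv, rfl⟩ := M.exists_pad_of_mem_CTreg hu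
      simpa [pad] using List.exists_mem_of_ne_nil v hv
    exact (key hne).1 ((h u hne).trans (M.autBM_behaviour_of_trace hne ⟨hu, hmax⟩))

end MinskyMachine

theorem mainTheorem8 (M : MinskyMachine) :
    -- `CT_reg` is a regular subset of `(Σ·□)⁺`
    M.CTreg.IsRegular ∧
    (∀ u ∈ M.CTreg, ∃ v : List M.Letter, v ≠ [] ∧ u = v.flatMap (fun x => [x, M.sqr])) ∧
    -- the behaviour of `A` takes values in `ℕ`, and it characterises acceptance
    (∀ u : List M.Letter, u ≠ [] → ∃ n : ℕ, M.autA.behaviour u = (n : WithBot ℕ)) ∧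
    (∀ m : ℕ, ¬ M.Accepts m ↔
      ∀ u ∈ M.CTreg, M.IsMaxInit m u →
        ∃ n : ℕ, M.autA.behaviour u = (n : WithBot ℕ) ∧ (u.length : ℚ) / 2 < n) ∧
    -- the behaviour of `A_M`
    (∀ u : List M.Letter, u ≠ [] →
      M.autAM.behaviour u = max ((u.length / 2 + 1 : ℕ) : WithBot ℕ) (M.autA.behaviour u)) ∧
    -- the behaviour of `B_M`
    (∀ x : List (Option M.Letter × Option M.Letter), x ≠ [] →
      (∀ (u : List M.Letter) (m : ℕ), u ≠ [] → x = convolution u (M.initWord m) →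
        (u ∈ M.CTreg ∧ M.IsMaxInit m u → M.autBM.behaviour x = M.autA.behaviour u) ∧
        (u ∉ M.CTreg ∨ ¬ M.IsMaxInit m u → M.autBM.behaviour x = M.autAM.behaviour u)) ∧
      ((¬ ∃ (u : List M.Letter) (m : ℕ), u ≠ [] ∧ x = convolution u (M.initWord m)) →
        M.autBM.behaviour x = 0)) ∧
    -- `r_{M,m}` takes values in `ℕ`
    (∀ (m : ℕ) (u : List M.Letter), u ≠ [] → ∃ n : ℕ, M.r m u = (n : WithBot ℕ)) ∧
    -- the equivalence
    (∀ m : ℕ, ¬ M.Accepts m ↔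
      ∀ u : List M.Letter, u ≠ [] → M.autAM.behaviour u = M.r m u) := by
  refine ⟨⟨M.CTState, inferInstance, M.ctDFA, rfl⟩, fun u hu => M.exists_pad_of_mem_CTreg hu,
    fun u hu => M.exists_autA_behaviour_eq_coe hu, M.not_accepts_iff,
    fun u hu => M.autAM_behaviour hu, fun x hx => ⟨?_, M.autBM_behaviour_of_not_valid hx⟩,
    fun m u hu => M.exists_r_eq_coe m hu, M.not_accepts_iff_behaviour_eq⟩
  rintro u m hu rfl
  exact ⟨M.autBM_behaviour_of_trace hu,
    fun h => M.autBM_behaviour_of_not_trace hu (not_and_or.2 h)⟩
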